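/- Let $T>0$ and let $X$ be a finite-dimensional real inner product space of dimension $n\ge 1$. Let $F:[0,T]\times X\to\mathbb R$ satisfy the following assumptions, where $\nabla_xF(t,u)$ is the gradient of $F(t,\cdot)$ at $u$, $\partial_tF$ is the partial derivative in time (one-sided at $t=0$ and $t=T$), and $\mathcal C(t):=\{u\in X:\nabla_xF(t,u)=0\}$. - (F0) $F\in C^1([0,T]\times X)$. - (F1) For every $\rho>0$ the set $\{u\in X:\ \sup_{t\in[0,T]}|F(t,u)|\le\rho\}$ is bounded. - (F2) There are $C_1,C_2>0$ such that $|\partial_tF(t,u)|\le C_1(F(t,u)+C_2)$ for all $(t,u)\in[0,T]\times X$. - (F3) For every $t\in[0,T]$ the set $\mathcal C(t)$ consists of isolated points. - (F4) For every $t\in[0,T]$ and $u\in\mathcal C(t)$, $\ \liminf_{v\to u}\dfrac{F(t,v)-F(t,u)}{\|\nabla_xF(t,v)\|}\ge 0$. - (F5) The map $t\mapsto\nabla_xF(t,u)$ is Lipschitz continuous on $[0,T]$, locally uniformly with respect to $u\in X$. Let $u^0\in X$. For $\varepsilon,\tau>0$ put $m:=\lfloor T/\tau\rfloor$ and $t^k:=k\tau$.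 A discrete solution is a family $u^0,u^1,\dots,u^m$ starting from the given $u^0$ with $$u^k\in\operatorname{argmin}_{x\in X}\Big\{F(t^k,x)+\frac{\varepsilon}{2\tau}\|x-u^{k-1}\|^2\Big\},\qquad k=1,\dots,m.$$ Its piecewise constant interpolant $\tilde u_{\varepsilon,\tau}:[0,T]\to X$ is defined by $\tilde u_{\varepsilon,\tau}(0)=u^0$, $\tilde u_{\varepsilon,\tau}(t)=u^k$ for $t\in(t^{k-1},t^k]$, $k=1,\dots,m$, and $\tilde u_{\varepsilon,\tau}(t)=u^m$ for $t\in(t^m,T]$. For $t\in[0,T]$ and $u_1,u_2\in X$ let $$c_t(u_1,u_2):=\inf\Big\{\int_0^1\|\dot\theta(s)\|\,\|\nabla_xF(t,\theta(s))\|\,ds:\ \theta\in \mathrm{AC}([0,1];X),\ \theta(0)=u_1,\ \theta(1)=u_2\Big\}.$$ Let $\varepsilon_j,\tau_j>0$ with $\varepsilon_j\to0$, $\tau_j\to 0$ and $\varepsilon_j/\tau_j\to+\infty$, and for each $j$ let $\tilde u_{\varepsilon_j,\tau_j}$ be the interpolant of a discrete solution for $(\varepsilon_j,\tau_j)$ with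 initial point $u^0$. Then there exist a subsequence (not relabelled) and a function $u:[0,T]\to X$ such that $\tilde u_{\varepsilon_j,\tau_j}(t)\to u(t)$ for every $t\in[0,T]$, and $u$ has the following properties. (i) $u$ is regulated: the right limit $u_+(t)$ exists for every $t\in[0,T)$ and the left limit $u_-(t)$ exists for every $t\in(0,T]$. We further set $u_-(0):=u(0)$ and $u_+(T):=u(T)$, and let $J:=\{t\in[0,T]:u_-(t)\ne u_+(t)\}$ be the jump set of $u$. (ii) $\nabla_xF(t,u_+(t))=0$ for every $t\in[0,T)$ and $\nabla_xF(t,u_-(t))=0$ for every $t\in(0,T]$. (iii) For all $0\le s\le t\le T$, the function $r\mapsto\partial_rF(r,u(r))$ is integrable on $[s,t]$, the sum below converges, and the energy balance $$F(t,u_+(t))+\sum_{r\in J\cap[s,t]}c_r(u_-(r),u_+(r))=F(s,u_-(s))+\int_s^t\partial_rF(r,u(r))\,dr$$ holds. That is, $u$ is a Balanced Viscosity solution of $\nabla_xF(t,u(t))=0$. -/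

import Mathlib

open Set Filter Topology MeasureTheory

noncomputable section

namespace MinMov

/-! An energy on `[0,T] × X` is given as a function `F : ℝ → X → ℝ`; only its values `F t x` with
`t ∈ [0,T]` are used. Likewise a curve `[0,T] → X` is given as a function `u : ℝ → X`
of which only the values on `[0,T]` are used. -/

/-- The gradient `∇ₓ F(t,x)` of `F(t,·)` at `x`. -/
def gradX {X : Type*} [NormedAddCommGroup X] [InnerProductSpace ℝ X] [FiniteDimensional ℝ X]
    (F : ℝ → X → ℝ) (t : ℝ) (x : X) : X :=
  haveI : CompleteSpace X := FiniteDimensional.complete ℝ X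
  gradient (F t) x

/-- The partial derivative `∂ₜ F(t,x)` for `t ∈ [0,T]`, one-sided at `t = 0` and `t = T`. -/
def dtime {X : Type*} (T : ℝ) (F : ℝ → X → ℝ) (t : ℝ) (x : X) : ℝ :=
  derivWithin (fun r => F r x) (Icc 0 T) t

/-- The set `C(t)` of critical points of `F(t,·)`. -/
def criticalSet {X : Type*} [NormedAddCommGroup X] [InnerProductSpace ℝ X]
    [FiniteDimensional ℝ X] (F : ℝ → X → ℝ) (t : ℝ) : Set X :=
  {x | gradX F t x = 0}

/-- (F0): `F ∈ C¹([0,T] × X)`. -/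
def IsC1 {X : Type*} [NormedAddCommGroup X] [InnerProductSpace ℝ X]
    (T : ℝ) (F : ℝ → X → ℝ) : Prop :=
  ContDiffOn ℝ 1 (fun p : ℝ × X => F p.1 p.2) (Icc 0 T ×ˢ univ)

/-- (F1): the sublevel sets of `x ↦ sup_{t ∈ [0,T]} |F(t,x)|` are bounded. -/
def IsCoercive {X : Type*} [NormedAddCommGroup X] (T : ℝ) (F : ℝ → X → ℝ) : Prop :=
  ∀ ρ : ℝ, 0 < ρ →
    Bornology.IsBounded {x : X | sSup ((fun t => |F t x|) '' Icc 0 T) ≤ ρ}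

/-- (F2): the power is controlled by the energy. -/
def PowerControl {X : Type*} (T : ℝ) (F : ℝ → X → ℝ) : Prop :=
  ∃ C₁ C₂ : ℝ, 0 < C₁ ∧ 0 < C₂ ∧
    ∀ t ∈ Icc 0 T, ∀ x : X, |dtime T F t x| ≤ C₁ * (F t x + C₂)

/-- (F3): for every `t ∈ [0,T]` the critical set `C(t)` consists of isolated points. -/
def IsolatedCritical {X : Type*} [NormedAddCommGroup X] [InnerProductSpace ℝ X]
    [FiniteDimensional ℝ X] (T : ℝ) (F : ℝ → X → ℝ) : Prop :=
  ∀ t ∈ Icc 0 T, ∀ x ∈ criticalSet F t, ∀ᶠ y in 𝓝[≠] x, y ∉ criticalSet F t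

/-- (F4): `liminf_{v → x} (F(t,v) - F(t,x)) / ‖∇ₓ F(t,v)‖ ≥ 0` at every critical point `x` of
`F(t,·)`, the lower limit being taken in the extended reals. -/
def LiminfCondition {X : Type*} [NormedAddCommGroup X] [InnerProductSpace ℝ X]
    [FiniteDimensional ℝ X] (T : ℝ) (F : ℝ → X → ℝ) : Prop :=
  ∀ t ∈ Icc 0 T, ∀ x ∈ criticalSet F t,
    0 ≤ liminf (fun v => (((F t v - F t x) / ‖gradX F t v‖ : ℝ) : EReal)) (𝓝[≠] x)

/-- (F5): `t ↦ ∇ₓ F(t,x)` is Lipschitz on `[0,T]`, locally uniformly in `x`. -/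
def GradLipschitzInTime {X : Type*} [NormedAddCommGroup X] [InnerProductSpace ℝ X]
    [FiniteDimensional ℝ X] (T : ℝ) (F : ℝ → X → ℝ) : Prop :=
  ∀ x₀ : X, ∃ L : NNReal, ∀ᶠ x in 𝓝 x₀, LipschitzOnWith L (fun t => gradX F t x) (Icc 0 T)

/-- `U 0, U 1, …, U m` with `m = ⌊T/τ⌋` is a discrete solution of the minimizing movement scheme
with initial point `u₀`, viscosity `ε` and time step `τ`: for `k = 1, …, m`, the point `U k`
minimizes `F(kτ, x) + ε/(2τ) ‖x - U (k-1)‖²` over `x ∈ X`.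
(The values `U k` with `k > m` are not used.) -/
def IsDiscreteSolution {X : Type*} [NormedAddCommGroup X]
    (T : ℝ) (F : ℝ → X → ℝ) (u₀ : X) (ε τ : ℝ) (U : ℕ → X) : Prop :=
  U 0 = u₀ ∧ ∀ k : ℕ, 1 ≤ k → k ≤ ⌊T / τ⌋₊ →
    IsMinOn (fun x => F (k * τ) x + ε / (2 * τ) * ‖x - U (k - 1)‖ ^ 2) univ (U k)

/-- The left-continuous piecewise constant interpolant: with `m = ⌊T/τ⌋`, its value is `U 0` at
`t = 0`, `U k` for `t ∈ ((k-1)τ, kτ]`, `1 ≤ k ≤ m`, and `U m` for `t ∈ (mτ, T]`. -/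
def interpolant {X : Type*} (T τ : ℝ) (U : ℕ → X) (t : ℝ) : X :=
  U (min ⌈t / τ⌉₊ ⌊T / τ⌋₊)

/-- `u : [0,T] → X` is regulated: it has a right limit at every `t ∈ [0,T)` and a left limit at
every `t ∈ (0,T]`. -/
def IsRegulated {X : Type*} [TopologicalSpace X] (T : ℝ) (u : ℝ → X) : Prop :=
  (∀ t ∈ Ico 0 T, ∃ l, Tendsto u (𝓝[>] t) (𝓝 l)) ∧
    ∀ t ∈ Ioc 0 T, ∃ l, Tendsto u (𝓝[<] t) (𝓝 l)

/-- `u₊(t)`, with the convention `u₊(T) = u(T)`. -/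
def uPlus {X : Type*} [TopologicalSpace X] (T : ℝ) (u : ℝ → X) (t : ℝ) : X :=
  if t < T then Function.rightLim u t else u t

/-- `u₋(t)`, with the convention `u₋(0) = u(0)`. -/
def uMinus {X : Type*} [TopologicalSpace X] (u : ℝ → X) (t : ℝ) : X :=
  if 0 < t then Function.leftLim u t else u t

/-- The jump set of `u : [0,T] → X`. -/
def jumpSet {X : Type*} [TopologicalSpace X] (T : ℝ) (u : ℝ → X) : Set ℝ :=
  {t ∈ Icc 0 T | uMinus u t ≠ uPlus T u t}

/-- The transition cost `c_t(x,y)`: the infimum of `∫₀¹ ‖θ'(s)‖ ‖∇ₓ F(t,θ(s))‖ ds` over the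
absolutely continuous curves `θ` on `[0,1]` from `x` to `y`. -/
def cost {X : Type*} [NormedAddCommGroup X] [InnerProductSpace ℝ X] [FiniteDimensional ℝ X]
    (F : ℝ → X → ℝ) (t : ℝ) (x y : X) : ℝ :=
  sInf {a : ℝ | ∃ θ : ℝ → X, AbsolutelyContinuousOnInterval θ 0 1 ∧ θ 0 = x ∧ θ 1 = y ∧
    a = ∫ s in (0 : ℝ)..1, ‖deriv θ s‖ * ‖gradX F t (θ s)‖}

end MinMov

end

namespace MinMov

/-! Let a step of a discrete solution release the energy `drop`, evaluated at the new time.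
Telescoping gives an exact discrete balance: energy equals initial energy plus `work` minus
`dissip`. Minimality makes `dissip` monotone in the step; (F1) and (F2) bound the solutions and
`dissip` uniformly, so Helly's theorem yields a monotone limit `D`.

The key estimate is `exists_transition_bounds`. Since ε/τ → ∞, steps are uniformly small, and the
Euler equation makes each step antiparallel to the gradient at its endpoint. Away from critical
points a step therefore releases almost length times gradient norm. By (F3) only finitely many
critical points matter, and each small ball around one is crossed at once, from first to last visit,
at negligible cost. So near any time r both displacement and transition cost are bounded by the
dissipated energy, up to δ. Hence the interpolants converge wherever `D` is continuous, and a
further extraction handles the countably many other times. The limit `u` inherits one-sided limits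
from `D`, and F(t,u(t)) = F(0,u₀) + ∫ ∂ₜF - D(t).

If the gradient were nonzero at a continuity point of `D`, about e/τ steps would each release at
least a multiple of τ/ε, which is impossible as ε → 0; one-sided limits are then critical by
density. At a jump, the transition estimate bounds the cost above by the jump of `D`, and the chain
rule bounds it below (`IsLimit.cost_eq`).

It remains to exclude a diffuse part of `D`. By (F4) and (F5) the right-continuous version of `D`
has zero right derivative on [0,T) (`IsLimit.rightLim_sub_le`), so its Stieltjes measure lives on
the jumps (`Monotone.stieltjes_measure_diff_eq_zero`), and the costs sum to the whole increment of
`D`. -/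

theorem dtime_of_notMem {X : Type*} {T : ℝ} {F : ℝ → X → ℝ} {t : ℝ} (ht : t ∉ Icc 0 T) (x : X) :
    dtime T F t x = 0 :=
  derivWithin_zero_of_notMem_closure (by rwa [isClosed_Icc.closure_eq])

/-! ### Derivatives of the energy in time and space -/

section Regularity

variable {X : Type*} [NormedAddCommGroup X] [InnerProductSpace ℝ X] {T : ℝ} {F : ℝ → X → ℝ}

theorem uniqueDiffOn_cylinder (hT : 0 < T) :
    UniqueDiffOn ℝ (Icc (0 : ℝ) T ×ˢ (univ : Set X)) :=
  (uniqueDiffOn_Icc hT).prod uniqueDiffOn_univ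

theorem IsC1.continuousOn (hF0 : IsC1 T F) :
    ContinuousOn (fun p : ℝ × X => F p.1 p.2) (Icc 0 T ×ˢ univ) :=
  ContDiffOn.continuousOn hF0

theorem IsC1.hasFDerivWithinAt (hF0 : IsC1 T F) {t : ℝ} (ht : t ∈ Icc 0 T) (x : X) :
    HasFDerivWithinAt (fun p : ℝ × X => F p.1 p.2)
      (fderivWithin ℝ (fun p : ℝ × X => F p.1 p.2) (Icc 0 T ×ˢ univ) (t, x))
      (Icc 0 T ×ˢ univ) (t, x) :=
  ((ContDiffOn.differentiableOn hF0 one_ne_zero) (t, x) ⟨ht, mem_univ _⟩).hasFDerivWithinAt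

theorem IsC1.hasFDerivAt_slice (hF0 : IsC1 T F) {t : ℝ} (ht : t ∈ Icc 0 T) (x : X) :
    HasFDerivAt (F t)
      ((fderivWithin ℝ (fun p : ℝ × X => F p.1 p.2) (Icc 0 T ×ˢ univ) (t, x)).comp
        (ContinuousLinearMap.inr ℝ ℝ X)) x := by
  rw [← hasFDerivWithinAt_univ]
  have h1 : HasFDerivWithinAt (fun y : X => (t, y)) (ContinuousLinearMap.inr ℝ ℝ X) univ x :=
    (hasFDerivAt_prodMk_right t x).hasFDerivWithinAt
  exact (hF0.hasFDerivWithinAt ht x).comp x h1 (fun y _ => ⟨ht, mem_univ _⟩)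

theorem IsC1.hasDerivWithinAt_time (hF0 : IsC1 T F) {t : ℝ} (ht : t ∈ Icc 0 T) (x : X) :
    HasDerivWithinAt (fun r => F r x)
      (fderivWithin ℝ (fun p : ℝ × X => F p.1 p.2) (Icc 0 T ×ˢ univ) (t, x) (1, 0))
      (Icc 0 T) t := by
  have h1 : HasDerivWithinAt (fun r : ℝ => (r, x)) ((1 : ℝ), (0 : X)) (Icc 0 T) t :=
    (hasDerivWithinAt_id t _).prodMk (hasDerivWithinAt_const t _ x)
  have hm : MapsTo (fun r : ℝ => (r, x)) (Icc 0 T) (Icc 0 T ×ˢ univ) :=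
    fun y hy => ⟨hy, mem_univ _⟩
  exact (hF0.hasFDerivWithinAt ht x).comp_hasDerivWithinAt t h1 hm

theorem IsC1.hasDerivWithinAt_dtime (hF0 : IsC1 T F) {t : ℝ} (ht : t ∈ Icc 0 T)
    (x : X) : HasDerivWithinAt (fun r => F r x) (dtime T F t x) (Icc 0 T) t :=
  (hF0.hasDerivWithinAt_time ht x).differentiableWithinAt.hasDerivWithinAt

theorem IsC1.continuousOn_dtime (hF0 : IsC1 T F) (hT : 0 < T) :
    ContinuousOn (fun p : ℝ × X => dtime T F p.1 p.2) (Icc 0 T ×ˢ univ) := by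
  have h := (ContDiffOn.continuousOn_fderivWithin hF0 (uniqueDiffOn_cylinder hT) le_rfl).clm_apply
    (continuousOn_const (c := ((1 : ℝ), (0 : X))))
  refine h.congr fun p hp => ?_
  exact (hF0.hasDerivWithinAt_time hp.1 p.2).derivWithin ((uniqueDiffOn_Icc hT) _ hp.1)

variable [FiniteDimensional ℝ X]

theorem innerSL_gradX (t : ℝ) (x : X) : innerSL ℝ (gradX F t x) = fderiv ℝ (F t) x := by
  have : CompleteSpace X := FiniteDimensional.complete ℝ X
  ext v
  simp [gradX, gradient]

theorem gradX_eq (t : ℝ) (x : X) :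
    gradX F t x = (haveI : CompleteSpace X := FiniteDimensional.complete ℝ X
      (InnerProductSpace.toDual ℝ X).symm (fderiv ℝ (F t) x)) := rfl

theorem IsC1.hasFDerivAt_gradX (hF0 : IsC1 T F) {t : ℝ} (ht : t ∈ Icc 0 T) (x : X) :
    HasFDerivAt (F t) (innerSL ℝ (gradX F t x)) x := by
  rw [innerSL_gradX]
  exact (hF0.hasFDerivAt_slice ht x).differentiableAt.hasFDerivAt

theorem IsC1.continuousOn_gradX (hF0 : IsC1 T F) (hT : 0 < T) :
    ContinuousOn (fun p : ℝ × X => gradX F p.1 p.2) (Icc 0 T ×ˢ univ) := by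
  have : CompleteSpace X := FiniteDimensional.complete ℝ X
  have h := (ContDiffOn.continuousOn_fderivWithin hF0 (uniqueDiffOn_cylinder hT) le_rfl).clm_comp
    (continuousOn_const (c := ContinuousLinearMap.inr ℝ ℝ X))
  have h2 := (InnerProductSpace.toDual ℝ X).symm.continuous.comp_continuousOn h
  refine h2.congr fun p hp => ?_
  simp only [gradX_eq, Function.comp]
  rw [(hF0.hasFDerivAt_slice hp.1 p.2).fderiv]

theorem IsC1.continuous_gradX (hF0 : IsC1 T F) (hT : 0 < T) {t : ℝ} (ht : t ∈ Icc 0 T) :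
    Continuous (gradX F t) := by
  rw [← continuousOn_univ]
  exact (hF0.continuousOn_gradX hT).comp (f := fun x : X => (t, x)) (by fun_prop)
    (fun x _ => ⟨ht, mem_univ _⟩)

end Regularity

/-! ### Weighted lengths, transition costs and the chain rule -/

section Curves

theorem _root_.intervalIntegral.integral_congr_on_Ioo {f g : ℝ → ℝ} {a b : ℝ} (hab : a ≤ b)
    (h : ∀ s ∈ Ioo a b, f s = g s) : ∫ s in a..b, f s = ∫ s in a..b, g s := by
  rw [intervalIntegral.integral_of_le hab, intervalIntegral.integral_of_le hab,
    integral_Ioc_eq_integral_Ioo, integral_Ioc_eq_integral_Ioo]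
  exact setIntegral_congr_fun measurableSet_Ioo h

variable {X : Type*} [NormedAddCommGroup X] [InnerProductSpace ℝ X] [FiniteDimensional ℝ X]

/-- The points `x` and `y` are joined by a Lipschitz curve along which the integral of the weight
`g` with respect to the arc length is at most `a`. -/
def JoinedByCost (g : X → ℝ) (x y : X) (a : ℝ) : Prop :=
  ∃ (b : ℝ) (K : NNReal) (θ : ℝ → X), 0 < b ∧ LipschitzWith K θ ∧ (∀ s ≤ 0, θ s = x) ∧
    (∀ s, b ≤ s → θ s = y) ∧ ∫ s in (0 : ℝ)..b, ‖deriv θ s‖ * g (θ s) ≤ a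

/-- The infimum of the weighted lengths of the Lipschitz curves joining `x` and `y`. -/
noncomputable def lipCost (g : X → ℝ) (x y : X) : ℝ := sInf {a | JoinedByCost g x y a}

theorem _root_.LipschitzWith.intervalIntegrable_norm_deriv_mul {K : NNReal} {θ : ℝ → X}
    (hθ : LipschitzWith K θ) {g : X → ℝ} (hg : Continuous g) (a b : ℝ) :
    IntervalIntegrable (fun s => ‖deriv θ s‖ * g (θ s)) volume a b := by
  let _ : MeasurableSpace X := borel X
  have : BorelSpace X := ⟨rfl⟩
  have : CompleteSpace X := FiniteDimensional.complete ℝ X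
  have h1 : IntervalIntegrable (fun s => ‖deriv θ s‖) volume a b := by
    refine (intervalIntegrable_const (c := (K : ℝ)) (μ := volume) (a := a) (b := b)).mono_fun
      (measurable_deriv θ).norm.aestronglyMeasurable ?_
    refine Eventually.of_forall fun s => ?_
    simpa using norm_deriv_le_of_lipschitz hθ
  exact h1.mul_continuousOn (hg.comp hθ.continuous).continuousOn

/-- Curves constant outside their parameter interval concatenate by addition after a shift. This
keeps the Lipschitz property without gluing, and on each open piece the sum agrees locally with one
of the two curves. -/
theorem JoinedByCost.trans {g : X → ℝ} (hg : Continuous g) {x y z : X} {a a' : ℝ}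
    (h : JoinedByCost g x y a) (h' : JoinedByCost g y z a') : JoinedByCost g x z (a + a') := by
  obtain ⟨b₁, K₁, θ₁, hb₁, hL₁, hl₁, hr₁, hI₁⟩ := h
  obtain ⟨b₂, K₂, θ₂, hb₂, hL₂, hl₂, hr₂, hI₂⟩ := h'
  have hL : LipschitzWith (K₁ + K₂) (fun s => θ₁ s + (θ₂ (s - b₁) - y)) := by
    refine hL₁.add ?_
    have : LipschitzWith (K₂ * 1) (fun s : ℝ => θ₂ (s - b₁)) :=
      hL₂.comp (LipschitzWith.of_dist_le_mul fun s s' => by simp)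
    rw [mul_one] at this
    exact LipschitzWith.of_dist_le_mul fun s s' => by simpa using this.dist_le_mul s s'
  refine ⟨b₁ + b₂, K₁ + K₂, _, by positivity, hL, fun s hs => ?_, fun s hs => ?_, ?_⟩
  · simp [hl₁ s hs, hl₂ (s - b₁) (by linarith)]
  · simp [hr₁ s (by linarith), hr₂ (s - b₁) (by linarith)]
  · rw [← intervalIntegral.integral_add_adjacent_intervals
      (hL.intervalIntegrable_norm_deriv_mul hg 0 b₁)
      (hL.intervalIntegrable_norm_deriv_mul hg b₁ (b₁ + b₂))]
    refine add_le_add (le_trans (le_of_eq ?_) hI₁) (le_trans (le_of_eq ?_) hI₂)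
    · refine intervalIntegral.integral_congr_on_Ioo hb₁.le fun s hs => ?_
      have he : (fun s => θ₁ s + (θ₂ (s - b₁) - y)) =ᶠ[𝓝 s] θ₁ := by
        filter_upwards [Iio_mem_nhds hs.2] with r hr
        simp [hl₂ (r - b₁) (by linarith [mem_Iio.1 hr])]
      rw [he.deriv_eq, he.eq_of_nhds]
    · have hsh := intervalIntegral.integral_comp_sub_right
        (fun s => ‖deriv θ₂ s‖ * g (θ₂ s)) b₁ (a := b₁) (b := b₁ + b₂)
      rw [sub_self, add_sub_cancel_left] at hsh
      rw [← hsh]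
      refine intervalIntegral.integral_congr_on_Ioo (by linarith) fun s hs => ?_
      have he : (fun s => θ₁ s + (θ₂ (s - b₁) - y)) =ᶠ[𝓝 s] fun s => θ₂ (s - b₁) := by
        filter_upwards [Ioi_mem_nhds hs.1] with r hr
        simp [hr₁ r (mem_Ioi.1 hr).le]
      rw [he.deriv_eq, he.eq_of_nhds, deriv_comp_sub_const]

omit [FiniteDimensional ℝ X] in
theorem joinedByCost_segment {g : X → ℝ} (hg0 : ∀ z, 0 ≤ g z) {x y : X} {M : ℝ}
    (hM : ∀ z ∈ segment ℝ x y, g z ≤ M) : JoinedByCost g x y (M * ‖y - x‖) := by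
  set p : ℝ → ℝ := fun s => max 0 (min s 1) with hp
  have hpL : LipschitzWith 1 p := (LipschitzWith.id.min_const 1).const_max 0
  have hL : LipschitzWith ‖y - x‖₊ (fun s => x + p s • (y - x)) := by
    refine LipschitzWith.of_dist_le_mul fun s s' => ?_
    have := hpL.dist_le_mul s s'
    rw [dist_add_left, dist_eq_norm, ← sub_smul, norm_smul, mul_comm]
    simp only [NNReal.coe_one, one_mul] at this
    rw [coe_nnnorm, ← dist_eq_norm]
    exact mul_le_mul_of_nonneg_left this dist_nonneg
  refine ⟨1, _, _, one_pos, hL, fun s hs => ?_, fun s hs => ?_, ?_⟩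
  · simp [hp, hs, hs.trans zero_le_one]
  · simp [hp, hs]
  · refine (le_abs_self _).trans ?_
    have := intervalIntegral.norm_integral_le_of_norm_le_const (a := 0) (b := 1)
      (f := fun s => ‖deriv (fun s => x + p s • (y - x)) s‖ * g (x + p s • (y - x)))
      (C := M * ‖y - x‖) ?_
    · simpa using this
    · intro s _
      have hmem : x + p s • (y - x) ∈ segment ℝ x y := by
        rw [segment_eq_image']
        exact ⟨p s, ⟨le_max_left _ _, max_le zero_le_one (min_le_right _ _)⟩, rfl⟩
      rw [norm_mul, norm_norm, Real.norm_of_nonneg (hg0 _), mul_comm]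
      refine mul_le_mul (hM _ hmem) ?_ (norm_nonneg _) ((hg0 _).trans (hM _ hmem))
      simpa using norm_deriv_le_of_lipschitz hL

omit [FiniteDimensional ℝ X] in
theorem JoinedByCost.nonneg {g : X → ℝ} (hg0 : ∀ z, 0 ≤ g z) {x y : X} {a : ℝ}
    (h : JoinedByCost g x y a) : 0 ≤ a := by
  obtain ⟨b, K, θ, hb, -, -, -, hI⟩ := h
  exact (intervalIntegral.integral_nonneg hb.le
    fun s _ => mul_nonneg (norm_nonneg _) (hg0 _)).trans hI

omit [FiniteDimensional ℝ X] in
theorem bddBelow_joinedByCost {g : X → ℝ} (hg0 : ∀ z, 0 ≤ g z) (x y : X) :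
    BddBelow {a | JoinedByCost g x y a} := ⟨0, fun _ h => JoinedByCost.nonneg hg0 h⟩

omit [FiniteDimensional ℝ X] in
theorem nonempty_joinedByCost {g : X → ℝ} (hg : Continuous g) (hg0 : ∀ z, 0 ≤ g z) (x y : X) :
    {a | JoinedByCost g x y a}.Nonempty := by
  have hK : IsCompact (segment ℝ x y) := by
    rw [segment_eq_image']
    exact isCompact_Icc.image (by fun_prop)
  obtain ⟨M, hM⟩ := (hK.image hg).bddAbove
  exact ⟨_, joinedByCost_segment hg0 fun z hz => hM (mem_image_of_mem g hz)⟩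

theorem lipCost_triangle {g : X → ℝ} (hg : Continuous g) (hg0 : ∀ z, 0 ≤ g z) (x y z : X) :
    lipCost g x z ≤ lipCost g x y + lipCost g y z := by
  refine le_of_forall_pos_le_add fun δ hδ => ?_
  obtain ⟨a, ha, ha'⟩ := exists_lt_of_csInf_lt (nonempty_joinedByCost hg hg0 x y)
    (lt_add_of_pos_right _ (half_pos hδ))
  obtain ⟨b, hb, hb'⟩ := exists_lt_of_csInf_lt (nonempty_joinedByCost hg hg0 y z)
    (lt_add_of_pos_right _ (half_pos hδ))
  have := csInf_le (bddBelow_joinedByCost hg0 x z) (JoinedByCost.trans hg ha hb)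
  simp only [lipCost] at *
  linarith

omit [FiniteDimensional ℝ X] in
theorem lipCost_le_segment {g : X → ℝ} (hg0 : ∀ z, 0 ≤ g z) {x y : X} {M : ℝ}
    (hM : ∀ z ∈ segment ℝ x y, g z ≤ M) : lipCost g x y ≤ M * ‖y - x‖ :=
  csInf_le (bddBelow_joinedByCost hg0 x y) (joinedByCost_segment hg0 hM)

theorem tendsto_lipCost_zero {g : X → ℝ} (hg : Continuous g) (hg0 : ∀ z, 0 ≤ g z)
    {ι : Type*} {l : Filter ι} {v w : ι → X} {x : X} (hv : Tendsto v l (𝓝 x))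
    (hw : Tendsto w l (𝓝 x)) (δ : ℝ) (hδ : 0 < δ) :
    ∀ᶠ i in l, lipCost g (v i) (w i) ≤ δ := by
  obtain ⟨M, hM⟩ := ((isCompact_closedBall x 1).image hg).bddAbove
  have hM' : ∀ z ∈ Metric.closedBall x 1, g z ≤ M := fun z hz => hM (mem_image_of_mem g hz)
  have h0 : Tendsto (fun i => M * ‖w i - v i‖) l (𝓝 0) := by
    simpa using (hw.sub hv).norm.const_mul M
  filter_upwards [hv (Metric.closedBall_mem_nhds x one_pos),
    hw (Metric.closedBall_mem_nhds x one_pos), h0.eventually_le_const hδ] with i h1 h2 h3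
  exact (lipCost_le_segment hg0 fun z hz =>
    hM' z ((convex_closedBall x 1).segment_subset h1 h2 hz)).trans h3

/-- Moving an endpoint slightly costs little, by a short segment, so the triangle inequality passes
upper bounds to the limit. -/
theorem lipCost_le_of_tendsto {g : X → ℝ} (hg : Continuous g) (hg0 : ∀ z, 0 ≤ g z)
    {ι : Type*} {l : Filter ι} [l.NeBot] {v w : ι → X} {c : ι → ℝ} {x y : X} {a : ℝ}
    (hv : Tendsto v l (𝓝 x)) (hw : Tendsto w l (𝓝 y)) (hc : Tendsto c l (𝓝 a))
    (h : ∀ᶠ i in l, lipCost g (v i) (w i) ≤ c i) : lipCost g x y ≤ a := by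
  refine le_of_forall_pos_le_add fun δ hδ => ?_
  have h1 := tendsto_lipCost_zero hg hg0 (tendsto_const_nhds (x := x)) hv (δ / 3) (by positivity)
  have h2 := tendsto_lipCost_zero hg hg0 hw (tendsto_const_nhds (x := y)) (δ / 3) (by positivity)
  have h3 := hc.eventually_lt_const (show a < a + δ / 3 by linarith)
  obtain ⟨i, h1, h2, h3, h⟩ := (h1.and (h2.and (h3.and h))).exists
  have t1 := lipCost_triangle hg hg0 x (v i) y
  have t2 := lipCost_triangle hg hg0 (v i) (w i) y
  linarith

/-- The weighted length is invariant under the linear rescaling of [0,b] to [0,1]. -/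
theorem cost_le_of_joinedByCost {F : ℝ → X → ℝ} {t : ℝ} {x y : X} {a : ℝ}
    (h : JoinedByCost (fun z => ‖gradX F t z‖) x y a) : cost F t x y ≤ a := by
  obtain ⟨b, K, θ, hb, hL, hl, hr, hI⟩ := h
  refine le_trans (csInf_le ⟨0, ?_⟩ ⟨fun s => θ (b * s), ?_, ?_, ?_, rfl⟩) (le_trans ?_ hI)
  · rintro _ ⟨ψ, -, -, -, rfl⟩
    exact intervalIntegral.integral_nonneg zero_le_one fun s _ => by positivity
  · have : LipschitzWith (K * ‖b‖₊) (fun s : ℝ => θ (b * s)) :=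
      hL.comp (LipschitzWith.of_dist_le_mul fun s s' => by
        rw [Real.dist_eq, ← mul_sub, abs_mul]; rfl)
    exact this.lipschitzOnWith.absolutelyContinuousOnInterval
  · simp [hl]
  · simp [hr]
  · have h1 := intervalIntegral.mul_integral_comp_mul_left (a := 0) (b := 1)
      (f := fun s => ‖deriv θ s‖ * ‖gradX F t (θ s)‖) b
    rw [mul_zero, mul_one, ← intervalIntegral.integral_const_mul] at h1
    rw [← h1]
    refine le_of_eq (intervalIntegral.integral_congr fun s _ => ?_)
    simp only
    rw [deriv_comp_mul_left, norm_smul, Real.norm_of_nonneg hb.le, mul_assoc]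

theorem cost_le_lipCost {F : ℝ → X → ℝ} {t : ℝ} (hg : Continuous (gradX F t)) (x y : X) :
    cost F t x y ≤ lipCost (fun z => ‖gradX F t z‖) x y :=
  le_csInf (nonempty_joinedByCost hg.norm (fun _ => norm_nonneg _) x y)
    fun _ h => cost_le_of_joinedByCost h

theorem _root_.LipschitzOnWith.comp_absolutelyContinuousOnInterval {Y Z : Type*}
    [PseudoMetricSpace Y] [PseudoMetricSpace Z] {f : Y → Z} {K : NNReal} {S : Set Y}
    (hf : LipschitzOnWith K f S) {θ : ℝ → Y} {a b : ℝ}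
    (hθ : AbsolutelyContinuousOnInterval θ a b) (hS : MapsTo θ (uIcc a b) S) :
    AbsolutelyContinuousOnInterval (fun s => f (θ s)) a b := by
  rw [absolutelyContinuousOnInterval_iff] at hθ ⊢
  intro ε hε
  -- `K + 1` instead of `K` avoids dividing by zero.
  obtain ⟨δ, hδ, h⟩ := hθ (ε / (K + 1)) (by positivity)
  refine ⟨δ, hδ, fun E hE hEδ => ?_⟩
  calc ∑ i ∈ Finset.range E.1, dist (f (θ (E.2 i).1)) (f (θ (E.2 i).2))
      ≤ ∑ i ∈ Finset.range E.1, (K + 1 : ℝ) * dist (θ (E.2 i).1) (θ (E.2 i).2) := by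
        refine Finset.sum_le_sum fun i hi => ?_
        have h1 := hf.dist_le_mul _ (hS (hE.1 i hi).1) _ (hS (hE.1 i hi).2)
        have h2 : (0 : ℝ) ≤ dist (θ (E.2 i).1) (θ (E.2 i).2) := dist_nonneg
        linarith
    _ = (K + 1 : ℝ) * ∑ i ∈ Finset.range E.1, dist (θ (E.2 i).1) (θ (E.2 i).2) := by
        rw [Finset.mul_sum]
    _ < (K + 1 : ℝ) * (ε / (K + 1)) := by
        have := h E hE hEδ
        gcongr
    _ = ε := by field_simp

/-- In an orthonormal basis the coordinates are scalar absolutely continuous functions, whose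
derivatives are integrable and dominate ‖θ'‖. Where θ is not differentiable, `deriv` is zero by
convention. -/
theorem _root_.AbsolutelyContinuousOnInterval.intervalIntegrable_norm_deriv {θ : ℝ → X} {a b : ℝ}
    (hθ : AbsolutelyContinuousOnInterval θ a b) :
    IntervalIntegrable (fun s => ‖deriv θ s‖) volume a b := by
  let _ : MeasurableSpace X := borel X
  have : BorelSpace X := ⟨rfl⟩
  have : CompleteSpace X := FiniteDimensional.complete ℝ X
  set e := stdOrthonormalBasis ℝ X
  have hAC : ∀ i, AbsolutelyContinuousOnInterval (fun s => innerSL ℝ (e i) (θ s)) a b := fun i =>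
    ((innerSL ℝ (e i)).lipschitz.lipschitzOnWith (s := univ)).comp_absolutelyContinuousOnInterval
      hθ (mapsTo_univ _ _)
  have hsum : IntervalIntegrable
      (fun s => ∑ i, ‖deriv (fun s => innerSL ℝ (e i) (θ s)) s‖) volume a b :=
    (IntervalIntegrable.sum Finset.univ fun i _ => (hAC i).intervalIntegrable_deriv.norm).congr
      fun s _ => by simp
  refine hsum.mono_fun (measurable_deriv θ).norm.aestronglyMeasurable
    (Eventually.of_forall fun s => ?_)
  simp only [norm_norm]
  refine le_trans ?_ (le_abs_self _)
  by_cases hd : DifferentiableAt ℝ θ s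
  · have h1 : ∀ i, deriv (fun s => innerSL ℝ (e i) (θ s)) s = innerSL ℝ (e i) (deriv θ s) :=
      fun i => ((innerSL ℝ (e i)).hasFDerivAt.comp_hasDerivAt s hd.hasDerivAt).deriv
    simp only [h1]
    conv_lhs => rw [← e.sum_repr' (deriv θ s)]
    refine (norm_sum_le _ _).trans (Finset.sum_le_sum fun i _ => ?_)
    rw [norm_smul, e.norm_eq_one, mul_one]
    rfl
  · rw [deriv_zero_of_not_differentiableAt hd, norm_zero]
    positivity

/-- Along an absolutely continuous curve the energy changes at rate ⟨∇F, θ'⟩, which Cauchy–Schwarz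
bounds by the integrand of the cost. This is the lower bound for the cost of a jump. -/
theorem IsC1.sub_le_cost {T : ℝ} {F : ℝ → X → ℝ} (hF0 : IsC1 T F) (hT : 0 < T) {t : ℝ}
    (ht : t ∈ Icc 0 T) (x y : X) : F t x - F t y ≤ cost F t x y := by
  have hG := hF0.continuous_gradX hT ht
  -- The real infimum of the empty set is `0`, so a lower bound requires an admissible curve; the
  -- segment is one.
  have hne : {a : ℝ | ∃ θ : ℝ → X, AbsolutelyContinuousOnInterval θ 0 1 ∧ θ 0 = x ∧ θ 1 = y ∧
    a = ∫ s in (0 : ℝ)..1, ‖deriv θ s‖ * ‖gradX F t (θ s)‖}.Nonempty := by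
    refine ⟨_, fun s => x + s • (y - x), ?_, by simp, by simp, rfl⟩
    refine ContDiffOn.absolutelyContinuousOnInterval ?_
    fun_prop
  refine le_csInf hne ?_
  rintro _ ⟨θ, hθ, rfl, rfl, rfl⟩
  -- The energy is Lipschitz only on bounded sets, so the curve is first confined to a ball.
  obtain ⟨R, hR⟩ := hθ.exists_bound
  obtain ⟨M, hM⟩ := ((isCompact_closedBall (0 : X) R).image hG.norm).bddAbove
  have hLip : LipschitzOnWith M.toNNReal (F t) (Metric.closedBall 0 R) := by
    refine (convex_closedBall (0 : X) R).lipschitzOnWith_of_nnnorm_hasFDerivWithin_le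
      (fun z _ => (hF0.hasFDerivAt_gradX ht z).hasFDerivWithinAt) fun z hz => ?_
    rw [← NNReal.coe_le_coe, coe_nnnorm, innerSL_apply_norm]
    exact (hM (mem_image_of_mem _ hz)).trans (Real.le_coe_toNNReal M)
  have hAC : AbsolutelyContinuousOnInterval (fun s => F t (θ s)) 0 1 :=
    hLip.comp_absolutelyContinuousOnInterval hθ fun s hs => by simpa using hR s hs
  have hFTC := hAC.integral_deriv_eq_sub
  have hint : IntervalIntegrable (fun s => ‖deriv θ s‖ * ‖gradX F t (θ s)‖) volume 0 1 :=
    hθ.intervalIntegrable_norm_deriv.mul_continuousOn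
      (hG.norm.comp_continuousOn hθ.continuousOn)
  have hle := intervalIntegral.norm_integral_le_of_norm_le (μ := volume) zero_le_one
    (f := deriv fun s => F t (θ s)) (g := fun s => ‖deriv θ s‖ * ‖gradX F t (θ s)‖) ?_ hint
  · rw [hFTC, Real.norm_eq_abs, abs_sub_comm] at hle
    exact (le_abs_self _).trans hle
  · filter_upwards [hθ.boundedVariationOn.ae_differentiableAt_of_mem_uIcc] with s hs hs'
    have hd := hs (by rw [uIcc_of_le zero_le_one]; exact Ioc_subset_Icc_self hs')
    have h1 : deriv (fun s => F t (θ s)) s = innerSL ℝ (gradX F t (θ s)) (deriv θ s) :=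
      ((hF0.hasFDerivAt_gradX ht (θ s)).comp_hasDerivAt s hd.hasDerivAt).deriv
    rw [h1, mul_comm]
    exact norm_inner_le_norm _ _

end Curves

/-! ### A priori bounds and the Euler equation for discrete solutions -/

section APriori

variable {X : Type*} [NormedAddCommGroup X] [InnerProductSpace ℝ X] {T : ℝ} {F : ℝ → X → ℝ}

theorem IsC1.continuousOn_time (hF0 : IsC1 T F) (x : X) :
    ContinuousOn (fun r => F r x) (Icc 0 T) :=
  hF0.continuousOn.comp (f := fun r : ℝ => (r, x)) (by fun_prop) fun _ hr => ⟨hr, mem_univ _⟩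

theorem IsC1.hasDerivAt_dtime (hF0 : IsC1 T F) {t : ℝ} (ht : t ∈ Ioo 0 T) (x : X) :
    HasDerivAt (fun r => F r x) (dtime T F t x) t :=
  (hF0.hasDerivWithinAt_dtime (Ioo_subset_Icc_self ht) x).hasDerivAt (Icc_mem_nhds ht.1 ht.2)

theorem IsC1.continuousOn_dtime_slice (hF0 : IsC1 T F) (hT : 0 < T) (x : X) :
    ContinuousOn (fun r => dtime T F r x) (Icc 0 T) :=
  (hF0.continuousOn_dtime hT).comp (f := fun r : ℝ => (r, x)) (by fun_prop)
    fun _ hr => ⟨hr, mem_univ _⟩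

theorem IsC1.integral_dtime (hF0 : IsC1 T F) (hT : 0 < T) {s t : ℝ} (hs : 0 ≤ s) (hst : s ≤ t)
    (ht : t ≤ T) (x : X) : ∫ r in s..t, dtime T F r x = F t x - F s x := by
  refine intervalIntegral.integral_eq_sub_of_hasDerivAt_of_le hst
    ((hF0.continuousOn_time x).mono (Icc_subset_Icc hs ht))
    (fun r hr => hF0.hasDerivAt_dtime ⟨hs.trans_lt hr.1, hr.2.trans_le ht⟩ x) ?_
  refine ContinuousOn.intervalIntegrable ?_
  rw [uIcc_of_le hst]
  exact (hF0.continuousOn_dtime_slice hT x).mono (Icc_subset_Icc hs ht)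

/-- Gronwall in both time directions: by (F2), F + C₂ times exp(-C₁r) decreases in r and times
exp(C₁r) increases. -/
theorem IsC1.energy_le_exp_mul (hF0 : IsC1 T F) {C₁ C₂ : ℝ}
    (hC : ∀ t ∈ Icc 0 T, ∀ x : X, |dtime T F t x| ≤ C₁ * (F t x + C₂)) {s t : ℝ}
    (hs : s ∈ Icc 0 T) (ht : t ∈ Icc 0 T) (x : X) :
    F t x + C₂ ≤ Real.exp (C₁ * |t - s|) * (F s x + C₂) := by
  have key : ∀ c : ℝ, ∀ r ∈ Ioo 0 T, HasDerivAt (fun r => Real.exp (c * r) * (F r x + C₂))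
      (Real.exp (c * r) * (c * (F r x + C₂) + dtime T F r x)) r := by
    intro c r hr
    have h1 : HasDerivAt (fun r : ℝ => Real.exp (c * r)) (Real.exp (c * r) * (c * 1)) r :=
      ((hasDerivAt_id r).const_mul c).exp
    have h2 := h1.mul ((hF0.hasDerivAt_dtime hr x).add_const C₂)
    exact h2.congr_deriv (by ring)
  have hcont : ∀ c : ℝ, ContinuousOn (fun r => Real.exp (c * r) * (F r x + C₂)) (Icc 0 T) :=
    fun c => ContinuousOn.mul (by fun_prop) ((hF0.continuousOn_time x).add continuousOn_const)
  have hexp : ∀ c a b A : ℝ, Real.exp (c * a) * A = Real.exp (c * b) * (Real.exp (c * (a - b)) * A) := by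
    intro c a b A
    rw [← mul_assoc, ← Real.exp_add]
    ring_nf
  rcases le_total s t with hst | hst
  · have hanti : AntitoneOn (fun r => Real.exp (-C₁ * r) * (F r x + C₂)) (Icc 0 T) := by
      refine antitoneOn_of_deriv_nonpos (convex_Icc 0 T) (hcont _) ?_ ?_
      · rw [interior_Icc]
        exact fun r hr => (key _ r hr).differentiableAt.differentiableWithinAt
      · rw [interior_Icc]
        intro r hr
        rw [(key _ r hr).deriv]
        refine mul_nonpos_of_nonneg_of_nonpos (Real.exp_nonneg _) ?_
        have := (abs_le.1 (hC r (Ioo_subset_Icc_self hr) x)).2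
        linarith
    have h := hanti hs ht hst
    simp only at h
    rw [hexp (-C₁) s t] at h
    have h' := le_of_mul_le_mul_left h (Real.exp_pos _)
    rwa [abs_of_nonneg (by linarith), show C₁ * (t - s) = -C₁ * (s - t) by ring]
  · have hmono : MonotoneOn (fun r => Real.exp (C₁ * r) * (F r x + C₂)) (Icc 0 T) := by
      refine monotoneOn_of_deriv_nonneg (convex_Icc 0 T) (hcont _) ?_ ?_
      · rw [interior_Icc]
        exact fun r hr => (key _ r hr).differentiableAt.differentiableWithinAt
      · rw [interior_Icc]
        intro r hr
        rw [(key _ r hr).deriv]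
        refine mul_nonneg (Real.exp_nonneg _) ?_
        have := (abs_le.1 (hC r (Ioo_subset_Icc_self hr) x)).1
        linarith
    have h := hmono ht hs hst
    simp only at h
    rw [hexp C₁ s t] at h
    have h' := le_of_mul_le_mul_left h (Real.exp_pos _)
    rwa [abs_of_nonpos (by linarith), neg_sub]

omit [NormedAddCommGroup X] [InnerProductSpace ℝ X] in
theorem energy_nonneg {C₁ C₂ : ℝ} (hC₁ : 0 < C₁)
    (hC : ∀ t ∈ Icc 0 T, ∀ x : X, |dtime T F t x| ≤ C₁ * (F t x + C₂)) {t : ℝ}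
    (ht : t ∈ Icc 0 T) (x : X) : 0 ≤ F t x + C₂ :=
  nonneg_of_mul_nonneg_right ((abs_nonneg _).trans (hC t ht x)) hC₁

/-- Coercivity (F1) concerns the supremum over all times; Gronwall transfers a bound at one time to
every other. -/
theorem exists_norm_le_of_energy_le (hT : 0 < T) (hF0 : IsC1 T F) (hF1 : IsCoercive T F)
    (hF2 : PowerControl T F) (M : ℝ) : ∃ R : ℝ, ∀ s ∈ Icc 0 T, ∀ x : X, F s x ≤ M → ‖x‖ ≤ R := by
  obtain ⟨C₁, C₂, hC₁, hC₂, hC⟩ := hF2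
  set ρ := Real.exp (C₁ * T) * (|M| + C₂) + C₂
  obtain ⟨R, hR⟩ := (hF1 ρ (by positivity)).exists_norm_le
  refine ⟨R, fun s hs x hx => hR x ?_⟩
  change sSup ((fun t => |F t x|) '' Icc 0 T) ≤ ρ
  refine csSup_le ((nonempty_Icc.2 hT.le).image _) ?_
  rintro _ ⟨t, ht, rfl⟩
  have h0 := energy_nonneg hC₁ hC ht x
  have h0s := energy_nonneg hC₁ hC hs x
  have h1 := hF0.energy_le_exp_mul hC hs ht x
  have h2 : Real.exp (C₁ * |t - s|) * (F s x + C₂) ≤ Real.exp (C₁ * T) * (|M| + C₂) := by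
    have : |t - s| ≤ T := abs_sub_le_iff.2 ⟨by linarith [ht.2, hs.1], by linarith [hs.2, ht.1]⟩
    have := le_abs_self M
    gcongr
    linarith
  rw [abs_le]
  constructor
  · have : 0 ≤ Real.exp (C₁ * T) * (|M| + C₂) := by positivity
    simp only [ρ]; linarith
  · simp only [ρ]; linarith

variable {u₀ : X} {ε τ : ℝ} {U : ℕ → X}

theorem natCast_mul_mem_Icc (hτ : 0 < τ) (hT : 0 ≤ T) {k : ℕ} (hk : k ≤ ⌊T / τ⌋₊) :
    (k : ℝ) * τ ∈ Icc 0 T := by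
  refine ⟨by positivity, ?_⟩
  rw [← le_div_iff₀ hτ]
  exact (Nat.le_floor_iff (by positivity)).1 hk

/-- The energy released in the `k`-th jump of a discrete solution. -/
def drop (F : ℝ → X → ℝ) (τ : ℝ) (U : ℕ → X) (k : ℕ) : ℝ :=
  F ((k + 1 : ℕ) * τ) (U k) - F ((k + 1 : ℕ) * τ) (U (k + 1))

/-- The energy released in the first `n` jumps of a discrete solution. -/
def dissip (F : ℝ → X → ℝ) (τ : ℝ) (U : ℕ → X) (n : ℕ) : ℝ :=
  ∑ k ∈ Finset.range n, drop F τ U k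

/-- The work of the time dependent energy during the first `n` steps of a discrete solution. -/
def work (F : ℝ → X → ℝ) (τ : ℝ) (U : ℕ → X) (n : ℕ) : ℝ :=
  ∑ k ∈ Finset.range n, (F ((k + 1 : ℕ) * τ) (U k) - F (k * τ) (U k))

omit [InnerProductSpace ℝ X] in
-- A telescoping identity, not an inequality; this exactness survives in the limit balance.
theorem IsDiscreteSolution.energy_eq (hU : IsDiscreteSolution T F u₀ ε τ U) (n : ℕ) :
    F (n * τ) (U n) = F 0 u₀ + work F τ U n - dissip F τ U n := by
  induction n with
  | zero => simp [work, dissip, hU.1]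
  | succ n ih =>
    simp only [work, dissip, Finset.sum_range_succ] at ih ⊢
    have hd : drop F τ U n = F ((n + 1 : ℕ) * τ) (U n) - F ((n + 1 : ℕ) * τ) (U (n + 1)) := rfl
    linarith

omit [InnerProductSpace ℝ X] in
-- Compare the minimizer with the competitor `U k`.
theorem IsDiscreteSolution.sq_le_drop (hU : IsDiscreteSolution T F u₀ ε τ U) {k : ℕ}
    (hk : k + 1 ≤ ⌊T / τ⌋₊) : ε / (2 * τ) * ‖U (k + 1) - U k‖ ^ 2 ≤ drop F τ U k := by
  have h := hU.2 (k + 1) (by omega) hk (mem_univ (U k))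
  simp only [mem_ofPred_eq, Nat.add_sub_cancel, sub_self, norm_zero] at h
  simp only [drop]
  linarith

omit [InnerProductSpace ℝ X] in
theorem IsDiscreteSolution.drop_nonneg (hU : IsDiscreteSolution T F u₀ ε τ U) (hε : 0 < ε)
    (hτ : 0 < τ) {k : ℕ} (hk : k + 1 ≤ ⌊T / τ⌋₊) : 0 ≤ drop F τ U k :=
  le_trans (by positivity) (hU.sq_le_drop hk)

omit [InnerProductSpace ℝ X] in
theorem IsDiscreteSolution.dissip_mono (hU : IsDiscreteSolution T F u₀ ε τ U) (hε : 0 < ε)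
    (hτ : 0 < τ) {k n : ℕ} (hkn : k ≤ n) (hn : n ≤ ⌊T / τ⌋₊) :
    dissip F τ U k ≤ dissip F τ U n := by
  induction n, hkn using Nat.le_induction with
  | base => rfl
  | succ n hkn ih =>
    have := hU.drop_nonneg hε hτ hn
    have := ih (by omega)
    simp only [dissip, Finset.sum_range_succ] at *
    linarith

theorem IsDiscreteSolution.energy_add_le (hU : IsDiscreteSolution T F u₀ ε τ U) (hT : 0 < T)
    (hF0 : IsC1 T F) (hε : 0 < ε) (hτ : 0 < τ) {C₁ C₂ : ℝ}
    (hC : ∀ t ∈ Icc 0 T, ∀ x : X, |dtime T F t x| ≤ C₁ * (F t x + C₂)) {k : ℕ}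
    (hk : k ≤ ⌊T / τ⌋₊) :
    F (k * τ) (U k) + C₂ ≤ Real.exp (C₁ * (k * τ)) * (F 0 u₀ + C₂) := by
  induction k with
  | zero => simp [hU.1]
  | succ k ih =>
    have h1 := ih (by omega)
    have h2 := hU.drop_nonneg hε hτ hk
    have h3 := hF0.energy_le_exp_mul hC (natCast_mul_mem_Icc hτ hT.le (by omega : k ≤ _))
      (natCast_mul_mem_Icc hτ hT.le hk) (U k)
    have h4 : |((k + 1 : ℕ) : ℝ) * τ - k * τ| = τ := by
      push_cast
      rw [show ((k : ℝ) + 1) * τ - k * τ = τ by ring, abs_of_pos hτ]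
    rw [h4] at h3
    have h5 := mul_le_mul_of_nonneg_left h1 (Real.exp_pos (C₁ * τ)).le
    rw [← mul_assoc, ← Real.exp_add] at h5
    have h6 : C₁ * τ + C₁ * (k * τ) = C₁ * ((k + 1 : ℕ) * τ) := by push_cast; ring
    rw [h6] at h5
    simp only [drop] at h2
    linarith

theorem exists_norm_discreteSolution_le (hT : 0 < T) (hF0 : IsC1 T F) (hF1 : IsCoercive T F)
    (hF2 : PowerControl T F) (u₀ : X) : ∃ R : ℝ, ∀ (ε τ : ℝ) (U : ℕ → X), 0 < ε → 0 < τ →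
      IsDiscreteSolution T F u₀ ε τ U → ∀ k ≤ ⌊T / τ⌋₊, ‖U k‖ ≤ R := by
  obtain ⟨C₁, C₂, hC₁, hC₂, hC⟩ := id hF2
  obtain ⟨R, hR⟩ := exists_norm_le_of_energy_le hT hF0 hF1 hF2
    (Real.exp (C₁ * T) * (F 0 u₀ + C₂))
  refine ⟨R, fun ε τ U hε hτ hU k hk => hR _ (natCast_mul_mem_Icc hτ hT.le hk) _ ?_⟩
  have h1 := hU.energy_add_le hT hF0 hε hτ hC hk
  have h2 := energy_nonneg hC₁ hC ⟨le_rfl, hT.le⟩ u₀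
  have h3 := (natCast_mul_mem_Icc hτ hT.le hk).2
  have h4 : Real.exp (C₁ * (k * τ)) * (F 0 u₀ + C₂) ≤ Real.exp (C₁ * T) * (F 0 u₀ + C₂) := by
    gcongr
  linarith

variable [FiniteDimensional ℝ X]

theorem IsC1.exists_abs_dtime_le (hF0 : IsC1 T F) (hT : 0 < T) (R : ℝ) :
    ∃ C : ℝ, 0 ≤ C ∧ ∀ (t : ℝ) (x : X), ‖x‖ ≤ R → |dtime T F t x| ≤ C := by
  have hK : IsCompact (Icc 0 T ×ˢ Metric.closedBall (0 : X) R) :=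
    isCompact_Icc.prod (isCompact_closedBall _ _)
  obtain ⟨C, hC⟩ := (hK.image_of_continuousOn
    ((hF0.continuousOn_dtime hT).mono (prod_mono_right (subset_univ _))).abs).bddAbove
  refine ⟨max C 0, le_max_right _ _, fun t x hx => ?_⟩
  by_cases ht : t ∈ Icc 0 T
  · exact le_max_of_le_left (hC ⟨(t, x), ⟨ht, by simpa using hx⟩, rfl⟩)
  · rw [dtime_of_notMem ht, abs_zero]
    exact le_max_right _ _

/-- By the discrete balance, dissipation is at most initial energy plus work minus final energy. The
energy is bounded below by -C₂, and the work is at most C·T because the power is bounded on the ball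
containing all discrete solutions. -/
theorem exists_dissip_le (hT : 0 < T) (hF0 : IsC1 T F) (hF1 : IsCoercive T F)
    (hF2 : PowerControl T F) (u₀ : X) : ∃ B : ℝ, ∀ (ε τ : ℝ) (U : ℕ → X), 0 < ε → 0 < τ →
      IsDiscreteSolution T F u₀ ε τ U → ∀ k ≤ ⌊T / τ⌋₊, dissip F τ U k ≤ B := by
  obtain ⟨R, hR⟩ := exists_norm_discreteSolution_le hT hF0 hF1 hF2 u₀
  obtain ⟨C, hC0, hC⟩ := hF0.exists_abs_dtime_le hT R
  obtain ⟨C₁, C₂, hC₁, hC₂, hC'⟩ := id hF2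
  refine ⟨F 0 u₀ + C₂ + C * T, fun ε τ U hε hτ hU k hk => ?_⟩
  have h1 := hU.energy_eq k
  have h2 := energy_nonneg hC₁ hC' (natCast_mul_mem_Icc hτ hT.le hk) (U k)
  have h3 : work F τ U k ≤ C * (k * τ) := by
    calc work F τ U k ≤ ∑ i ∈ Finset.range k, C * τ := by
          refine Finset.sum_le_sum fun i hi => ?_
          have hi' : i + 1 ≤ ⌊T / τ⌋₊ := (Finset.mem_range.1 hi).trans_le hk
          have hle : (i : ℝ) * τ ≤ (i + 1 : ℕ) * τ := by push_cast; nlinarith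
          rw [← hF0.integral_dtime hT (by positivity) hle (natCast_mul_mem_Icc hτ hT.le hi').2]
          refine (Real.le_norm_self _).trans ((intervalIntegral.norm_integral_le_of_norm_le_const
            fun r _ => hC r (U i) (hR ε τ U hε hτ hU i (by omega))).trans (le_of_eq ?_))
          push_cast
          rw [show ((i : ℝ) + 1) * τ - i * τ = τ by ring, abs_of_pos hτ]
      _ = C * (k * τ) := by simp; ring
  have h4 : C * (k * τ) ≤ C * T :=
    mul_le_mul_of_nonneg_left (natCast_mul_mem_Icc hτ hT.le hk).2 hC0
  linarith

theorem IsDiscreteSolution.euler (hU : IsDiscreteSolution T F u₀ ε τ U) (hF0 : IsC1 T F)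
    (hT : 0 < T) (hτ : 0 < τ) {k : ℕ} (hk : k + 1 ≤ ⌊T / τ⌋₊) :
    gradX F ((k + 1 : ℕ) * τ) (U (k + 1)) = -((ε / τ) • (U (k + 1) - U k)) := by
  have h := hU.2 (k + 1) (by omega) hk
  rw [Nat.add_sub_cancel] at h
  have hd1 := hF0.hasFDerivAt_gradX (natCast_mul_mem_Icc hτ hT.le hk) (U (k + 1))
  have hd2 : HasFDerivAt (fun x : X => ‖x - U k‖ ^ 2)
      (2 • (innerSL ℝ (U (k + 1) - U k)).comp (ContinuousLinearMap.id ℝ X)) (U (k + 1)) :=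
    ((hasFDerivAt_id (U (k + 1))).sub_const (U k)).norm_sq
  have h0 := (h.isLocalMin univ_mem).hasFDerivAt_eq_zero (hd1.add (hd2.const_mul (ε / (2 * τ))))
  generalize gradX F ((k + 1 : ℕ) * τ) (U (k + 1)) = G at h0 ⊢
  refine ext_inner_right ℝ fun v => ?_
  have h1 := congrArg (fun L => L v) h0
  simp at h1
  rw [inner_neg_left, inner_smul_left]
  simp only [conj_trivial]
  rw [eq_neg_iff_add_eq_zero, ← h1, inner_sub_left]
  field_simp

theorem IsDiscreteSolution.norm_gradX (hU : IsDiscreteSolution T F u₀ ε τ U) (hF0 : IsC1 T F)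
    (hT : 0 < T) (hε : 0 < ε) (hτ : 0 < τ) {k : ℕ} (hk : k + 1 ≤ ⌊T / τ⌋₊) :
    ‖gradX F ((k + 1 : ℕ) * τ) (U (k + 1))‖ = ε / τ * ‖U (k + 1) - U k‖ := by
  rw [hU.euler hF0 hT hτ hk, norm_neg, norm_smul, Real.norm_of_nonneg (by positivity)]

theorem IsDiscreteSolution.sq_norm_gradX_le_drop (hU : IsDiscreteSolution T F u₀ ε τ U)
    (hF0 : IsC1 T F) (hT : 0 < T) (hε : 0 < ε) (hτ : 0 < τ) {k : ℕ} (hk : k + 1 ≤ ⌊T / τ⌋₊) :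
    τ / (2 * ε) * ‖gradX F ((k + 1 : ℕ) * τ) (U (k + 1))‖ ^ 2 ≤ drop F τ U k := by
  refine le_trans (le_of_eq ?_) (hU.sq_le_drop hk)
  rw [hU.norm_gradX hF0 hT hε hτ hk]
  field_simp

/-- The gradient at `b` is antiparallel to the step, so the first-order term is exactly gradient
norm times length; the mean value inequality bounds the error by `ω` times the length. -/
theorem IsC1.sub_ge_of_segment (hF0 : IsC1 T F) {t : ℝ} (ht : t ∈ Icc 0 T) {a b : X} {ω c : ℝ}
    (hω : ∀ z ∈ segment ℝ a b, ‖gradX F t z - gradX F t b‖ ≤ ω) (hc : 0 ≤ c)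
    (hb : gradX F t b = -(c • (b - a))) :
    (‖gradX F t b‖ - ω) * ‖b - a‖ ≤ F t a - F t b := by
  have h := (convex_segment (𝕜 := ℝ) a b).norm_image_sub_le_of_norm_hasFDerivWithin_le'
    (f := F t) (f' := fun z => innerSL ℝ (gradX F t z)) (φ := innerSL ℝ (gradX F t b)) (C := ω)
    (fun z _ => (hF0.hasFDerivAt_gradX ht z).hasFDerivWithinAt)
    (fun z hz => by rw [← map_sub, innerSL_apply_norm]; exact hω z hz)
    (right_mem_segment ℝ a b) (left_mem_segment ℝ a b)
  have h1 : innerSL ℝ (gradX F t b) (a - b) = ‖gradX F t b‖ * ‖b - a‖ := by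
    rw [innerSL_apply_apply, hb, norm_neg, norm_smul, Real.norm_of_nonneg hc, ← neg_sub b a,
      inner_neg_neg, inner_smul_left, real_inner_self_eq_norm_sq]
    simp only [conj_trivial]
    ring
  rw [h1, norm_sub_rev a b, Real.norm_eq_abs] at h
  have := (abs_le.1 h).1
  linarith

end APriori

/-! ### Crossing finitely many cheap regions -/

section Chains

/-- A chain of points whose steps are either controlled by `M * a k` or end in one of finitely many
"cheap" regions, labelled by `S`, is controlled by the sum of the `a k`, because every cheap region
can be crossed at once. -/
theorem chain_le {X α : Type*} [DecidableEq α] {Φ : X → X → ℝ} (hself : ∀ x, Φ x x ≤ 0)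
    (htri : ∀ x y z, Φ x z ≤ Φ x y + Φ y z) {U : ℕ → X} {a : ℕ → ℝ} {M η : ℝ} (hM : 0 ≤ M)
    (hη : 0 ≤ η) {B : α → ℕ → Prop} {n : ℕ} (S : Finset α) {m : ℕ} (hmn : m ≤ n)
    (ha : ∀ k, m ≤ k → k < n → 0 ≤ a k)
    (hstep : ∀ k, m ≤ k → k < n → Φ (U k) (U (k + 1)) ≤ M * a k ∨ ∃ p ∈ S, B p (k + 1))
    (hcut : ∀ p ∈ S, ∀ k l, m ≤ k → k ≤ l → l < n → B p (k + 1) → B p (l + 1) →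
      Φ (U k) (U (l + 1)) ≤ η) :
    Φ (U m) (U n) ≤ S.card * η + M * ∑ k ∈ Finset.Ico m n, a k := by
  induction hd : n - m using Nat.strong_induction_on generalizing S m with
  | _ d ih =>
  have hsum : ∀ l, m ≤ l → ∑ k ∈ Finset.Ico l n, a k ≤ ∑ k ∈ Finset.Ico m n, a k := fun l hl =>
    Finset.sum_le_sum_of_subset_of_nonneg (Finset.Ico_subset_Ico_left hl) fun k hk _ =>
      ha k (Finset.mem_Ico.1 hk).1 (Finset.mem_Ico.1 hk).2
  rcases hmn.eq_or_lt with rfl | hlt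
  · have := hself (U m)
    simp only [Finset.Ico_self, Finset.sum_empty, mul_zero, add_zero]
    exact this.trans (by positivity)
  by_cases hp : ∃ p ∈ S, B p (m + 1)
  · obtain ⟨p, hpS, hpm⟩ := hp
    classical
    set A := (Finset.Ico m n).filter fun l => B p (l + 1) with hA
    have hmA : m ∈ A := by simp [hA, hlt, hpm]
    -- Jump to the last visit to region `p`. It is not met again afterwards, so `p` can be erased
    -- from `S`, and `η` is paid at most once per region.
    obtain ⟨l, hlA, hlmax⟩ := A.exists_max_image id ⟨m, hmA⟩
    simp only [hA, Finset.mem_filter, Finset.mem_Ico, id] at hlA hlmax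
    obtain ⟨⟨hml, hln⟩, hpl⟩ := hlA
    have h1 := hcut p hpS m l le_rfl hml hln hpm hpl
    have h2 := ih (n - (l + 1)) (by omega) (S.erase p) (by omega : l + 1 ≤ n)
      (fun k hk hk' => ha k (by omega) hk')
      (fun k hk hk' => (hstep k (by omega) hk').imp_right fun ⟨q, hq, hqk⟩ =>
        ⟨q, Finset.mem_erase.2 ⟨fun hqp => by
          have := hlmax k ⟨⟨by omega, hk'⟩, hqp ▸ hqk⟩
          omega, hq⟩, hqk⟩)
      (fun q hq k k' hk => hcut q (Finset.mem_of_mem_erase hq) k k' (by omega)) rfl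
    have h3 := htri (U m) (U (l + 1)) (U n)
    have h4 : ((S.erase p).card : ℝ) + 1 = S.card := by
      exact_mod_cast Finset.card_erase_add_one hpS
    have h5 := mul_le_mul_of_nonneg_left (hsum (l + 1) (by omega)) hM
    rw [← h4]
    linarith
  · have h1 := (hstep m le_rfl hlt).resolve_right hp
    have h2 := ih (n - (m + 1)) (by omega) S (Nat.succ_le_of_lt hlt)
      (fun k hk hk' => ha k (by omega) hk') (fun k hk hk' => hstep k (by omega) hk')
      (fun q hq k k' hk => hcut q hq k k' (by omega)) rfl
    have h3 := htri (U m) (U (m + 1)) (U n)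
    rw [Finset.sum_eq_sum_Ico_succ_bot hlt]
    linarith

end Chains

/-! ### Displacement and transition cost near a fixed time -/

section Transitions

variable {X : Type*} [NormedAddCommGroup X] [InnerProductSpace ℝ X] [FiniteDimensional ℝ X]
  {T : ℝ} {F : ℝ → X → ℝ}

omit [FiniteDimensional ℝ X] in
theorem lipCost_self_le {g : X → ℝ} (hg0 : ∀ z, 0 ≤ g z) (x : X) : lipCost g x x ≤ 0 := by
  simpa using lipCost_le_segment hg0 (x := x) (y := x) (M := g x) (by simp)

theorem finite_criticalSet_inter_closedBall (hT : 0 < T) (hF0 : IsC1 T F)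
    (hF3 : IsolatedCritical T F) {r : ℝ} (hr : r ∈ Icc 0 T) (R : ℝ) :
    (criticalSet F r ∩ Metric.closedBall 0 R).Finite := by
  by_contra hinf
  obtain ⟨x, -, hx⟩ := Set.Infinite.exists_accPt_of_subset_isCompact hinf
    (isCompact_closedBall (0 : X) R) inter_subset_right
  have hcl : IsClosed (criticalSet F r) :=
    isClosed_singleton.preimage (hF0.continuous_gradX hT hr)
  rw [accPt_iff_frequently_nhdsNE] at hx
  have hx' : ∃ᶠ y in 𝓝[≠] x, y ∈ criticalSet F r := hx.mono fun y hy => hy.1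
  have hxC : x ∈ criticalSet F r := by
    refine hcl.closure_subset (mem_closure_iff_frequently.2 (hx'.filter_mono nhdsWithin_le_nhds))
  exact hx' (hF3 r hr x hxC)

theorem IsC1.exists_dist_gradX_le (hF0 : IsC1 T F) (hT : 0 < T) (R : ℝ) {ω : ℝ} (hω : 0 < ω) :
    ∃ η > 0, ∀ t ∈ Icc 0 T, ∀ t' ∈ Icc 0 T, ∀ x y : X, ‖x‖ ≤ R → ‖y‖ ≤ R → |t - t'| ≤ η →
      ‖x - y‖ ≤ η → ‖gradX F t x - gradX F t' y‖ ≤ ω := by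
  have hK : IsCompact (Icc 0 T ×ˢ Metric.closedBall (0 : X) R) :=
    isCompact_Icc.prod (isCompact_closedBall _ _)
  have huc := hK.uniformContinuousOn_of_continuous
    ((hF0.continuousOn_gradX hT).mono (prod_mono_right (subset_univ _)))
  obtain ⟨δ, hδ, h⟩ := Metric.uniformContinuousOn_iff.1 huc ω hω
  refine ⟨δ / 2, by positivity, fun t ht t' ht' x y hx hy h1 h2 => ?_⟩
  have := h (t, x) ⟨ht, by simpa using hx⟩ (t', y) ⟨ht', by simpa using hy⟩ (by
    rw [Prod.dist_eq, max_lt_iff, Real.dist_eq, dist_eq_norm]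
    exact ⟨by simp only; linarith, by simp only; linarith⟩)
  rw [dist_eq_norm] at this
  exact this.le

theorem IsC1.exists_norm_gradX_le (hF0 : IsC1 T F) (hT : 0 < T) (R : ℝ) :
    ∃ C : ℝ, 0 ≤ C ∧ ∀ t ∈ Icc 0 T, ∀ x : X, ‖x‖ ≤ R → ‖gradX F t x‖ ≤ C := by
  have hK : IsCompact (Icc 0 T ×ˢ Metric.closedBall (0 : X) R) :=
    isCompact_Icc.prod (isCompact_closedBall _ _)
  obtain ⟨C, hC⟩ := (hK.image_of_continuousOn
    ((hF0.continuousOn_gradX hT).mono (prod_mono_right (subset_univ _))).norm).bddAbove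
  exact ⟨max C 0, le_max_right _ _, fun t ht x hx =>
    le_max_of_le_left (hC ⟨(t, x), ⟨ht, by simpa using hx⟩, rfl⟩)⟩

/-- Near a given time, the displacement and the transition cost between two points of a discrete
solution are controlled by the energy released between them. -/
theorem exists_transition_bounds (hT : 0 < T) (hF0 : IsC1 T F) (hF3 : IsolatedCritical T F)
    {r : ℝ} (hr : r ∈ Icc 0 T) (R : ℝ) {δ : ℝ} (hδ : 0 < δ) :
    ∃ η > 0, ∃ M ≥ 0, ∀ (u₀ : X) (ε τ : ℝ) (U : ℕ → X), 0 < ε → 0 < τ →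
      IsDiscreteSolution T F u₀ ε τ U → (∀ k ≤ ⌊T / τ⌋₊, ‖U k‖ ≤ R) →
      (∀ k, k + 1 ≤ ⌊T / τ⌋₊ → ‖U (k + 1) - U k‖ ≤ η) →
      ∀ m n : ℕ, m ≤ n → n ≤ ⌊T / τ⌋₊ → |m * τ - r| ≤ η → |n * τ - r| ≤ η →
        ‖U n - U m‖ ≤ δ + M * (dissip F τ U n - dissip F τ U m) ∧
        lipCost (fun z => ‖gradX F r z‖) (U m) (U n) ≤
          δ + (1 + δ) * (dissip F τ U n - dissip F τ U m) := by
  classical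
  have hGc := hF0.continuous_gradX hT hr
  -- Radius `R + 1` includes every critical point whose ρ-ball can meet the ball of radius `R`;
  -- below, `R + 3` contains the 2ρ-balls around these points, as ρ ≤ 1.
  have hfin := finite_criticalSet_inter_closedBall hT hF0 hF3 hr (R + 1)
  set S := hfin.toFinset with hS
  obtain ⟨C, hC0, hC⟩ := hF0.exists_norm_gradX_le hT (R + 3)
  -- Chosen so that crossing every critical ball once, over a distance of at most 4ρ and with
  -- gradient at most `C`, costs at most δ in all.
  set ρ : ℝ := min 1 (δ / (4 * (S.card + 1) * (C + 1))) with hρ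
  have hρ0 : 0 < ρ := lt_min one_pos (by positivity)
  have hρ1 : ρ ≤ 1 := min_le_left _ _
  have hρδ : (S.card + 1) * ((C + 1) * (4 * ρ)) ≤ δ := by
    have : ρ ≤ δ / (4 * (S.card + 1) * (C + 1)) := min_le_right _ _
    rw [le_div_iff₀ (by positivity)] at this
    linarith
  -- The complement of the critical balls is compact, so the gradient is bounded below there. Half
  -- of this bound survives passing from time `r` to the discrete time.
  obtain ⟨κ', hκ', hκS⟩ : ∃ κ' : ℝ, 0 < κ' ∧ ∀ x ∈ Metric.closedBall (0 : X) R \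
      ⋃ p ∈ S, Metric.ball p ρ, κ' ≤ ‖gradX F r x‖ := by
    refine IsCompact.exists_forall_le' ((isCompact_closedBall (0 : X) R).diff
      (isOpen_biUnion fun p _ => Metric.isOpen_ball)) hGc.norm.continuousOn fun x hx => ?_
    rw [norm_pos_iff]
    intro h0
    refine hx.2 (mem_biUnion (x := x) ?_ (Metric.mem_ball_self hρ0))
    have hx1 := hx.1
    simp only [Metric.mem_closedBall, dist_zero_right] at hx1
    simp only [hS, Finite.coe_toFinset, mem_inter_iff, Metric.mem_closedBall, dist_zero_right]
    exact ⟨h0, by linarith⟩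
  set κ := κ' / 2 with hκdef
  have hκ : 0 < κ := by positivity
  -- For G ≥ κ the first bound gives G - ω ≥ κ/2, hence the constant 2/κ; the second gives G + ω ≤
  -- (1 + δ)(G - ω), hence the factor 1 + δ in the cost estimate.
  set ω := min (κ / 2) (δ * κ / (2 + δ)) with hω
  have hω0 : 0 < ω := lt_min (by positivity) (by positivity)
  have hω1 : ω ≤ κ / 2 := min_le_left _ _
  have hω2 : ω * (2 + δ) ≤ δ * κ := by
    rw [← le_div_iff₀ (by positivity)]
    exact min_le_right _ _
  obtain ⟨η₀, hη₀, hη⟩ := hF0.exists_dist_gradX_le hT R hω0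
  refine ⟨min η₀ ρ, lt_min hη₀ hρ0, 2 / κ, by positivity, ?_⟩
  intro u₀ ε τ U hε hτ hU hR hst m n hmn hnm hmr hnr
  have hdrop : ∀ k, m ≤ k → k < n → 0 ≤ drop F τ U k := fun k _ hk =>
    hU.drop_nonneg hε hτ (by omega)
  have hsum : ∑ k ∈ Finset.Ico m n, drop F τ U k = dissip F τ U n - dissip F τ U m := by
    rw [Finset.sum_Ico_eq_sub _ hmn]; rfl
  have htime : ∀ k, m ≤ k → k < n → |r - (k + 1 : ℕ) * τ| ≤ η₀ := by
    intro k hk hk'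
    have h1 : (m : ℝ) * τ ≤ (k + 1 : ℕ) * τ := by
      have : (m : ℝ) ≤ (k + 1 : ℕ) := by exact_mod_cast (by omega : m ≤ k + 1)
      gcongr
    have h2 : ((k + 1 : ℕ) : ℝ) * τ ≤ n * τ := by
      have : ((k + 1 : ℕ) : ℝ) ≤ n := by exact_mod_cast hk'
      gcongr
    rw [abs_le] at *
    have := min_le_left η₀ ρ
    constructor <;> linarith
  -- the points of a segment of the discrete solution
  have hseg : ∀ k, m ≤ k → k < n → ∀ z ∈ segment ℝ (U k) (U (k + 1)),
      ‖z‖ ≤ R ∧ ‖z - U (k + 1)‖ ≤ η₀ := by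
    intro k hk hk' z hz
    constructor
    · have := (convex_closedBall (0 : X) R).segment_subset
        (by simpa using hR k (by omega)) (by simpa using hR (k + 1) (by omega)) hz
      simpa using this
    · have h1 : z ∈ Metric.closedBall (U (k + 1)) η₀ :=
        (convex_closedBall _ η₀).segment_subset (by
          rw [Metric.mem_closedBall, dist_comm, dist_eq_norm]
          exact (hst k (by omega)).trans (min_le_left _ _))
          (Metric.mem_closedBall_self hη₀.le) hz
      rwa [Metric.mem_closedBall, dist_eq_norm] at h1
  -- good steps
  have hgood : ∀ k, m ≤ k → k < n → (¬ ∃ p ∈ S, U (k + 1) ∈ Metric.ball p ρ) →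
      ‖U (k + 1) - U k‖ ≤ 2 / κ * drop F τ U k ∧
      lipCost (fun z => ‖gradX F r z‖) (U k) (U (k + 1)) ≤ (1 + δ) * drop F τ U k := by
    intro k hk hk' hbad
    have hk1 : k + 1 ≤ ⌊T / τ⌋₊ := by omega
    have htk := natCast_mul_mem_Icc hτ hT.le hk1
    have h1 : κ' ≤ ‖gradX F r (U (k + 1))‖ :=
      hκS _ ⟨by simpa using hR (k + 1) hk1, by simpa using hbad⟩
    have h2 := hη _ hr _ htk _ _ (hR (k + 1) hk1) (hR (k + 1) hk1) (htime k hk hk')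
      (by simpa using hη₀.le)
    have h3 : κ ≤ ‖gradX F ((k + 1 : ℕ) * τ) (U (k + 1))‖ := by
      have h4 := (norm_sub_norm_le _ _).trans h2
      have h5 : κ' = 2 * κ := by rw [hκdef]; ring
      linarith
    have h4 := hF0.sub_ge_of_segment htk (a := U k) (b := U (k + 1)) (ω := ω)
      (c := ε / τ) (fun z hz => hη _ htk _ htk _ _ (hseg k hk hk' z hz).1 (hR (k + 1) hk1)
        (by simpa using hη₀.le) (hseg k hk hk' z hz).2) (by positivity)
      (hU.euler hF0 hT hτ hk1)
    change _ ≤ drop F τ U k at h4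
    have hΔ := norm_nonneg (U (k + 1) - U k)
    set G := ‖gradX F ((k + 1 : ℕ) * τ) (U (k + 1))‖
    constructor
    · rw [div_mul_eq_mul_div, le_div_iff₀ hκ]
      nlinarith
    · have h5 : lipCost (fun z => ‖gradX F r z‖) (U k) (U (k + 1)) ≤
          (G + ω) * ‖U (k + 1) - U k‖ := by
        refine lipCost_le_segment (fun _ => norm_nonneg _) fun z hz => ?_
        have h6 := hη _ hr _ htk _ _ (hseg k hk hk' z hz).1 (hR (k + 1) hk1) (htime k hk hk')
          (hseg k hk hk' z hz).2
        have h7 := (norm_sub_norm_le _ _).trans h6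
        linarith
      refine h5.trans (le_trans ?_ (mul_le_mul_of_nonneg_left h4 (by positivity)))
      rw [← mul_assoc]
      refine mul_le_mul_of_nonneg_right ?_ hΔ
      nlinarith
  -- crossing a neighbourhood of a critical point
  have hnear : ∀ p ∈ S, ∀ k l, m ≤ k → k ≤ l → l < n → U (k + 1) ∈ Metric.ball p ρ →
      U (l + 1) ∈ Metric.ball p ρ →
      U k ∈ Metric.closedBall p (2 * ρ) ∧ U (l + 1) ∈ Metric.closedBall p (2 * ρ) ∧
        ‖U (l + 1) - U k‖ ≤ 4 * ρ := by
    intro p hp k l hk hkl hl h1 h2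
    have h3 := (hst k (by omega)).trans (min_le_right _ _)
    rw [Metric.mem_ball] at h1 h2
    rw [← dist_eq_norm] at h3
    have h4 : dist (U k) p ≤ 2 * ρ := by
      have := dist_triangle (U k) (U (k + 1)) p
      rw [dist_comm (U k) (U (k + 1))] at this
      linarith
    refine ⟨h4, by rw [Metric.mem_closedBall]; linarith, ?_⟩
    rw [← dist_eq_norm]
    have := dist_triangle_right (U (l + 1)) (U k) p
    linarith
  have hcard : (S.card : ℝ) ≤ S.card + 1 := by linarith
  have hstep4 : (S.card : ℝ) * (4 * ρ) ≤ δ := by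
    refine le_trans ?_ hρδ
    refine mul_le_mul hcard ?_ (by positivity) (by positivity)
    nlinarith
  have hstepC : (S.card : ℝ) * (C * (4 * ρ)) ≤ δ := by
    refine le_trans ?_ hρδ
    refine mul_le_mul hcard ?_ (by positivity) (by positivity)
    gcongr
    linarith
  have hno : ∀ k, m ≤ k → k < n → ∀ {P : Prop},
      ((¬ ∃ p ∈ S, U (k + 1) ∈ Metric.ball p ρ) → P) →
      (P ∨ ∃ p ∈ S, U (k + 1) ∈ Metric.ball p ρ) := by
    intro k _ _ P h
    by_cases hb : ∃ p ∈ S, U (k + 1) ∈ Metric.ball p ρ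
    · exact Or.inr hb
    · exact Or.inl (h hb)
  constructor
  · have h := chain_le (Φ := fun x y : X => ‖y - x‖) (by simp)
      (fun x y z => by
        have := norm_add_le (z - y) (y - x)
        rw [sub_add_sub_cancel] at this
        linarith)
      (U := U) (a := drop F τ U) (M := 2 / κ) (η := 4 * ρ) (by positivity) (by positivity)
      (B := fun p k => U k ∈ Metric.ball p ρ) S hmn hdrop
      (fun k hk hk' => hno k hk hk' fun hb => (hgood k hk hk' hb).1)
      (fun p hp k l hk hkl hl h1 h2 => (hnear p hp k l hk hkl hl h1 h2).2.2)
    rw [hsum] at h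
    linarith
  · have h := chain_le (Φ := lipCost fun z => ‖gradX F r z‖)
      (lipCost_self_le fun _ => norm_nonneg _)
      (lipCost_triangle hGc.norm fun _ => norm_nonneg _)
      (U := U) (a := drop F τ U) (M := 1 + δ) (η := C * (4 * ρ)) (by positivity) (by positivity)
      (B := fun p k => U k ∈ Metric.ball p ρ) S hmn hdrop
      (fun k hk hk' => hno k hk hk' fun hb => (hgood k hk hk' hb).2)
      (fun p hp k l hk hkl hl h1 h2 => by
        obtain ⟨h3, h4, h5⟩ := hnear p hp k l hk hkl hl h1 h2
        refine (lipCost_le_segment (fun _ => norm_nonneg _) (M := C) fun z hz => ?_).trans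
          (mul_le_mul_of_nonneg_left h5 hC0)
        refine hC r hr z ?_
        have hz' := (convex_closedBall p (2 * ρ)).segment_subset h3 h4 hz
        have hpS : ‖p‖ ≤ R + 1 := by
          have : p ∈ criticalSet F r ∩ Metric.closedBall 0 (R + 1) := by simpa [hS] using hp
          simpa using this.2
        rw [Metric.mem_closedBall, dist_eq_norm] at hz'
        have := norm_le_norm_add_norm_sub' z p
        linarith)
    rw [hsum] at h
    linarith

/-- The steps of the discrete solutions are uniformly small. -/
theorem eventually_norm_step_le (hT : 0 < T) (hF0 : IsC1 T F) {u₀ : X} {ε τ : ℕ → ℝ}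
    (hε : ∀ j, 0 < ε j) (hτ : ∀ j, 0 < τ j)
    (hετ : Tendsto (fun j => ε j / τ j) atTop atTop) {U : ℕ → ℕ → X}
    (hU : ∀ j, IsDiscreteSolution T F u₀ (ε j) (τ j) (U j)) {R : ℝ}
    (hR : ∀ j, ∀ k ≤ ⌊T / τ j⌋₊, ‖U j k‖ ≤ R) {η : ℝ} (hη : 0 < η) :
    ∀ᶠ j in atTop, ∀ k, k + 1 ≤ ⌊T / τ j⌋₊ → ‖U j (k + 1) - U j k‖ ≤ η := by
  obtain ⟨C, hC0, hC⟩ := hF0.exists_norm_gradX_le hT R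
  -- By the Euler equation a step has length τ/ε times a gradient norm bounded by `C`.
  filter_upwards [hετ.eventually_ge_atTop (C / η + 1)] with j hj k hk
  have h1 := (hU j).norm_gradX hF0 hT (hε j) (hτ j) hk
  have h2 := hC _ (natCast_mul_mem_Icc (hτ j) hT.le hk) _ (hR j _ hk)
  rw [h1] at h2
  by_contra! hlt
  have h3 : C / η * η < ε j / τ j * ‖U j (k + 1) - U j k‖ := by
    have : C / η < ε j / τ j := by linarith
    refine mul_lt_mul'' this hlt (by positivity) hη.le
  rw [div_mul_cancel₀ _ hη.ne'] at h3
  linarith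

end Transitions

/-! ### Compactness and Helly's theorem -/

section Selection

theorem exists_subseq_tendsto_on_countable {Y : Type*} [PseudoMetricSpace Y] {K : Set Y}
    (hK : IsCompact K) {ι : Type*} {f : ℕ → ι → Y} (hf : ∀ j t, f j t ∈ K) {Q : Set ι}
    (hQ : Q.Countable) :
    ∃ φ : ℕ → ℕ, StrictMono φ ∧ ∀ q ∈ Q, ∃ y, Tendsto (fun j => f (φ j) q) atTop (𝓝 y) := by
  have : Countable Q := hQ.to_subtype
  have hKc : IsCompact (Set.pi univ fun _ : Q => K) := isCompact_univ_pi fun _ => hK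
  obtain ⟨y, -, φ, hφ, hy⟩ := hKc.tendsto_subseq (x := fun j (q : Q) => f j q)
    (fun j q _ => hf j q)
  exact ⟨φ, hφ, fun q hq => ⟨y ⟨q, hq⟩, (tendsto_pi_nhds.1 hy) ⟨q, hq⟩⟩⟩

/-- **Helly's selection theorem** for uniformly bounded sequences of monotone functions. -/
theorem exists_subseq_tendsto_of_monotone {f : ℕ → ℝ → ℝ} (hf : ∀ j, Monotone (f j)) {A B : ℝ}
    (hA : ∀ j t, A ≤ f j t) (hB : ∀ j t, f j t ≤ B) :
    ∃ (φ : ℕ → ℕ) (g : ℝ → ℝ), StrictMono φ ∧ Monotone g ∧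
      ∀ t, Tendsto (fun j => f (φ j) t) atTop (𝓝 (g t)) := by
  have hmem : ∀ j t, f j t ∈ Icc A B := fun j t => ⟨hA j t, hB j t⟩
  obtain ⟨φ, hφ, hφQ⟩ := exists_subseq_tendsto_on_countable isCompact_Icc hmem
    (countable_range ((↑) : ℚ → ℝ))
  -- A monotone candidate, attained as a limit at rationals. Squeezing between rationals gives
  -- convergence at its continuity points; a second extraction treats the countable remainder.
  set g : ℝ → ℝ := fun t => limsup (fun j => f (φ j) t) atTop with hg
  have hbdd : ∀ t, IsBoundedUnder (· ≤ ·) atTop fun j => f (φ j) t := fun t =>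
    isBoundedUnder_of ⟨B, fun j => hB _ t⟩
  have hcob : ∀ t, IsCoboundedUnder (· ≤ ·) atTop fun j => f (φ j) t := fun t =>
    (isBoundedUnder_of ⟨A, fun j => hA _ t⟩ : IsBoundedUnder (· ≥ ·) atTop _).isCoboundedUnder_le
  have hgm : Monotone g := fun s t hst =>
    limsup_le_limsup (Eventually.of_forall fun j => hf _ hst) (hcob s) (hbdd t)
  have hgQ : ∀ q : ℚ, Tendsto (fun j => f (φ j) q) atTop (𝓝 (g q)) := by
    intro q
    obtain ⟨y, hy⟩ := hφQ q (mem_range_self q)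
    have : g q = y := hy.limsup_eq
    rwa [this]
  have hgc : ∀ t, ContinuousAt g t → Tendsto (fun j => f (φ j) t) atTop (𝓝 (g t)) := by
    intro t ht
    rw [Metric.tendsto_nhds]
    intro δ hδ
    obtain ⟨η, hη, h⟩ := Metric.continuousAt_iff.1 ht (δ / 2) (by positivity)
    obtain ⟨q, hq1, hq2⟩ := exists_rat_btwn (show t - η < t by linarith)
    obtain ⟨p, hp1, hp2⟩ := exists_rat_btwn (show t < t + η by linarith)
    have hq := h (x := (q : ℝ)) (by rw [Real.dist_eq, abs_lt]; constructor <;> linarith)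
    have hp := h (x := (p : ℝ)) (by rw [Real.dist_eq, abs_lt]; constructor <;> linarith)
    rw [Real.dist_eq, abs_lt] at hq hp
    filter_upwards [Metric.tendsto_nhds.1 (hgQ q) (δ / 2) (by positivity),
      Metric.tendsto_nhds.1 (hgQ p) (δ / 2) (by positivity)] with j h1 h2
    rw [Real.dist_eq, abs_lt] at *
    have h3 := hf (φ j) hq2.le
    have h4 := hf (φ j) hp1.le
    constructor <;> linarith
  obtain ⟨ψ, hψ, hψQ⟩ := exists_subseq_tendsto_on_countable isCompact_Icc
    (fun j t => hmem (φ j) t) hgm.countable_not_continuousAt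
  have hlim : ∀ t, ∃ y, Tendsto (fun j => f (φ (ψ j)) t) atTop (𝓝 y) := by
    intro t
    by_cases ht : ContinuousAt g t
    · exact ⟨_, (hgc t ht).comp hψ.tendsto_atTop⟩
    · exact hψQ t ht
  choose G hG using hlim
  exact ⟨φ ∘ ψ, G, hφ.comp hψ, fun s t hst =>
    le_of_tendsto_of_tendsto' (hG s) (hG t) fun j => hf _ hst, hG⟩

/-- Used to carry convergence from rational times to a nearby time. -/
theorem cauchySeq_of_forall_exists_cauchySeq {Y : Type*} [PseudoMetricSpace Y] {v : ℕ → Y}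
    (h : ∀ δ > 0, ∃ w : ℕ → Y, CauchySeq w ∧ ∀ᶠ j in atTop, dist (v j) (w j) ≤ δ) :
    CauchySeq v := by
  rw [Metric.cauchySeq_iff]
  intro ε hε
  obtain ⟨w, hw, hvw⟩ := h (ε / 4) (by positivity)
  obtain ⟨N, hN⟩ := Metric.cauchySeq_iff.1 hw (ε / 4) (by positivity)
  obtain ⟨N', hN'⟩ := eventually_atTop.1 hvw
  refine ⟨max N N', fun m hm n hn => ?_⟩
  have h1 := hN m (le_of_max_le_left hm) n (le_of_max_le_left hn)
  have h2 := hN' m (le_of_max_le_right hm)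
  have h3 := hN' n (le_of_max_le_right hn)
  have h4 := dist_triangle4 (v m) (w m) (w n) (v n)
  rw [dist_comm (w n)] at h4
  linarith

end Selection

/-! ### The time index of the interpolant -/

section TimeIndex

/-- The index of the discrete solution that the interpolant takes at time `t`. -/
noncomputable def timeIndex (T τ t : ℝ) : ℕ := min ⌈t / τ⌉₊ ⌊T / τ⌋₊

/-- The projection of `t` to `[0,T]`. -/
noncomputable def clamp (T t : ℝ) : ℝ := max 0 (min t T)

variable {T τ : ℝ}

theorem clamp_mem (hT : 0 ≤ T) (t : ℝ) : clamp T t ∈ Icc 0 T :=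
  ⟨le_max_left _ _, max_le hT (min_le_right _ _)⟩

theorem clamp_of_mem {t : ℝ} (ht : t ∈ Icc 0 T) : clamp T t = t := by
  rw [clamp, min_eq_left ht.2, max_eq_right ht.1]

theorem continuous_clamp : Continuous (clamp T) := by
  unfold clamp
  fun_prop

theorem abs_clamp_sub_le {r : ℝ} (hr : r ∈ Icc 0 T) (t : ℝ) : |clamp T t - r| ≤ |t - r| := by
  obtain ⟨h0, h1⟩ := hr
  simp only [clamp]
  grind

theorem timeIndex_le (t : ℝ) : timeIndex T τ t ≤ ⌊T / τ⌋₊ := min_le_right _ _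

theorem timeIndex_mono (hτ : 0 < τ) : Monotone (timeIndex T τ) := fun s t hst =>
  min_le_min_right _ (Nat.ceil_le_ceil (by gcongr))

/-- The interpolant extends constantly beyond [0,T]. Limits thus live on all of ℝ, and the endpoint
conventions for u₋(0) and u₊(T) become genuine one-sided limits. -/
theorem timeIndex_clamp (hτ : 0 < τ) (hT : 0 ≤ T) (t : ℝ) :
    timeIndex T τ (clamp T t) = timeIndex T τ t := by
  have hTi : ∀ s, T ≤ s → timeIndex T τ s = ⌊T / τ⌋₊ := fun s hs =>
    min_eq_right ((Nat.floor_le_ceil _).trans (Nat.ceil_le_ceil (by gcongr)))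
  have h0 : ∀ s, s ≤ 0 → timeIndex T τ s = 0 := fun s hs => by
    have : ⌈s / τ⌉₊ = 0 := Nat.ceil_eq_zero.2 (div_nonpos_of_nonpos_of_nonneg hs hτ.le)
    rw [timeIndex, this, min_eq_left (Nat.zero_le _)]
  rcases le_total t 0 with ht | ht
  · rw [h0 t ht, clamp, min_eq_left (ht.trans hT), max_eq_left ht, h0 0 le_rfl]
  rcases le_total T t with ht' | ht'
  · rw [hTi t ht', clamp, min_eq_right ht', max_eq_right hT, hTi T le_rfl]
  · rw [clamp_of_mem ⟨ht, ht'⟩]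

theorem abs_timeIndex_mul_sub_le (hτ : 0 < τ) {t : ℝ} (ht : t ∈ Icc 0 T) :
    |timeIndex T τ t * τ - t| ≤ τ := by
  have h1 : (⌈t / τ⌉₊ : ℝ) * τ < t + τ := by
    have := Nat.ceil_lt_add_one (show 0 ≤ t / τ from div_nonneg ht.1 hτ.le)
    have := mul_lt_mul_of_pos_right this hτ
    rwa [add_mul, div_mul_cancel₀ _ hτ.ne', one_mul] at this
  have h2 : t ≤ (⌈t / τ⌉₊ : ℝ) * τ := by
    rw [← div_le_iff₀ hτ]
    exact Nat.le_ceil _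
  have h3 : T < (⌊T / τ⌋₊ : ℝ) * τ + τ := by
    have := Nat.lt_floor_add_one (T / τ)
    rw [div_lt_iff₀ hτ] at this
    linarith
  rw [timeIndex, Nat.cast_min, min_mul_of_nonneg _ _ hτ.le, abs_le]
  constructor
  · have : t - τ ≤ min ((⌈t / τ⌉₊ : ℝ) * τ) (⌊T / τ⌋₊ * τ) :=
      le_min (by linarith) (by linarith [ht.2])
    linarith
  · linarith [min_le_left ((⌈t / τ⌉₊ : ℝ) * τ) (⌊T / τ⌋₊ * τ)]

theorem timeIndex_natCast_mul (hτ : 0 < τ) {k : ℕ} (hk : k ≤ ⌊T / τ⌋₊) :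
    timeIndex T τ (k * τ) = k := by
  rw [timeIndex, mul_div_cancel_right₀ _ hτ.ne', Nat.ceil_natCast, min_eq_left hk]

theorem interpolant_eq {X : Type*} (U : ℕ → X) (t : ℝ) :
    interpolant T τ U t = U (timeIndex T τ t) := rfl

end TimeIndex

/-! ### Pointwise convergence of a subsequence -/

section Limit

variable {X : Type*} [NormedAddCommGroup X] [InnerProductSpace ℝ X] [FiniteDimensional ℝ X]
  {T : ℝ} {F : ℝ → X → ℝ} {u₀ : X} {ε τ : ℕ → ℝ} {U : ℕ → ℕ → X}

/-- The energy released by a discrete solution up to time `t`. -/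
noncomputable def dissipAt (T : ℝ) (F : ℝ → X → ℝ) (τ : ℝ) (U : ℕ → X) (t : ℝ) : ℝ :=
  dissip F τ U (timeIndex T τ t)

omit [InnerProductSpace ℝ X] [FiniteDimensional ℝ X] in
theorem IsDiscreteSolution.monotone_dissipAt {ε τ : ℝ} {U : ℕ → X}
    (hU : IsDiscreteSolution T F u₀ ε τ U) (hε : 0 < ε) (hτ : 0 < τ) :
    Monotone (dissipAt T F τ U) := fun _ _ hst =>
  hU.dissip_mono hε hτ (timeIndex_mono hτ hst) (timeIndex_le _)

/-- The transition bounds along the interpolants of a sequence of discrete solutions. -/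
theorem exists_interpolant_bounds (hT : 0 < T) (hF0 : IsC1 T F) (hF1 : IsCoercive T F)
    (hF2 : PowerControl T F) (hF3 : IsolatedCritical T F)
    (hε : ∀ j, 0 < ε j) (hτ : ∀ j, 0 < τ j) (hτ0 : Tendsto τ atTop (𝓝 0))
    (hετ : Tendsto (fun j => ε j / τ j) atTop atTop)
    (hU : ∀ j, IsDiscreteSolution T F u₀ (ε j) (τ j) (U j)) {r : ℝ} (hr : r ∈ Icc 0 T)
    {δ : ℝ} (hδ : 0 < δ) :
    ∃ η > 0, ∃ M ≥ 0, ∀ᶠ j in atTop, ∀ s t, s ≤ t → |s - r| ≤ η → |t - r| ≤ η →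
      ‖interpolant T (τ j) (U j) t - interpolant T (τ j) (U j) s‖ ≤
        δ + M * (dissipAt T F (τ j) (U j) t - dissipAt T F (τ j) (U j) s) ∧
      lipCost (fun z => ‖gradX F r z‖) (interpolant T (τ j) (U j) s)
          (interpolant T (τ j) (U j) t) ≤
        δ + (1 + δ) * (dissipAt T F (τ j) (U j) t - dissipAt T F (τ j) (U j) s) := by
  obtain ⟨R, hR⟩ := exists_norm_discreteSolution_le hT hF0 hF1 hF2 u₀
  have hR' : ∀ j, ∀ k ≤ ⌊T / τ j⌋₊, ‖U j k‖ ≤ R := fun j => hR _ _ _ (hε j) (hτ j) (hU j)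
  obtain ⟨η, hη, M, hM, h⟩ := exists_transition_bounds hT hF0 hF3 hr R hδ
  refine ⟨η / 2, by positivity, M, hM, ?_⟩
  filter_upwards [eventually_norm_step_le hT hF0 hε hτ hετ hU hR' hη,
    hτ0.eventually_le_const (show (0 : ℝ) < η / 2 by positivity)] with j hj hτj s t hst hs ht
  have hnear : ∀ s, |s - r| ≤ η / 2 → |timeIndex T (τ j) s * τ j - r| ≤ η := by
    intro s hs
    rw [← timeIndex_clamp (hτ j) hT.le s]
    have h1 := abs_timeIndex_mul_sub_le (hτ j) (clamp_mem hT.le s)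
    have h2 := abs_clamp_sub_le hr s
    have h3 := abs_sub_le (timeIndex T (τ j) (clamp T s) * τ j) (clamp T s) r
    linarith
  exact h u₀ (ε j) (τ j) (U j) (hε j) (hτ j) (hU j) (hR' j) hj _ _
    (timeIndex_mono (hτ j) hst) (timeIndex_le _) (hnear s hs) (hnear t ht)

/-- At a continuity point of `D`, a rational just to the right is separated by little dissipation,
hence by little displacement, and convergence there is already arranged. The rational may exceed
`T`, harmlessly by the constant extension. Discontinuities of `D` are countable and enter the
extraction. -/
theorem exists_limit (hT : 0 < T) (hF0 : IsC1 T F) (hF1 : IsCoercive T F)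
    (hF2 : PowerControl T F) (hF3 : IsolatedCritical T F)
    (hε : ∀ j, 0 < ε j) (hτ : ∀ j, 0 < τ j) (hτ0 : Tendsto τ atTop (𝓝 0))
    (hετ : Tendsto (fun j => ε j / τ j) atTop atTop)
    (hU : ∀ j, IsDiscreteSolution T F u₀ (ε j) (τ j) (U j)) :
    ∃ (φ : ℕ → ℕ) (u : ℝ → X) (D : ℝ → ℝ), StrictMono φ ∧ Monotone D ∧
      (∀ t, Tendsto (fun j => interpolant T (τ (φ j)) (U (φ j)) t) atTop (𝓝 (u t))) ∧
      ∀ t, Tendsto (fun j => dissipAt T F (τ (φ j)) (U (φ j)) t) atTop (𝓝 (D t)) := by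
  have : CompleteSpace X := FiniteDimensional.complete ℝ X
  obtain ⟨R, hR⟩ := exists_norm_discreteSolution_le hT hF0 hF1 hF2 u₀
  obtain ⟨B, hB⟩ := exists_dissip_le hT hF0 hF1 hF2 u₀
  have hDm : ∀ j, Monotone (dissipAt T F (τ j) (U j)) := fun j =>
    (hU j).monotone_dissipAt (hε j) (hτ j)
  obtain ⟨φ, D, hφ, hD, hφD⟩ := exists_subseq_tendsto_of_monotone hDm (A := 0) (B := B)
    (fun j t => by
      have := (hU j).dissip_mono (hε j) (hτ j) (Nat.zero_le _) (timeIndex_le (T := T) t)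
      simpa [dissip, dissipAt] using this)
    (fun j t => hB _ _ _ (hε j) (hτ j) (hU j) _ (timeIndex_le t))
  obtain ⟨ψ, hψ, hψQ⟩ := exists_subseq_tendsto_on_countable (isCompact_closedBall (0 : X) R)
    (f := fun j t => interpolant T (τ (φ j)) (U (φ j)) t)
    (fun j t => by
      simpa [interpolant_eq] using hR _ _ _ (hε _) (hτ _) (hU (φ j)) _ (timeIndex_le (T := T) t))
    ((countable_range ((↑) : ℚ → ℝ)).union hD.countable_not_continuousAt)
  set χ := φ ∘ ψ with hχ
  have hχm : StrictMono χ := hφ.comp hψ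
  have hχD : ∀ t, Tendsto (fun j => dissipAt T F (τ (χ j)) (U (χ j)) t) atTop (𝓝 (D t)) :=
    fun t => (hφD t).comp hψ.tendsto_atTop
  have hlim : ∀ t ∈ Icc 0 T, ∃ y,
      Tendsto (fun j => interpolant T (τ (χ j)) (U (χ j)) t) atTop (𝓝 y) := by
    intro t ht
    by_cases htD : ContinuousAt D t
    · refine cauchySeq_tendsto_of_complete (cauchySeq_of_forall_exists_cauchySeq fun δ hδ => ?_)
      obtain ⟨η, hη, M, hM, h⟩ := exists_interpolant_bounds hT hF0 hF1 hF2 hF3 hε hτ hτ0 hετ hU ht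
        (half_pos hδ)
      obtain ⟨η', hη', h'⟩ := Metric.continuousAt_iff.1 htD (δ / (4 * (M + 1))) (by positivity)
      obtain ⟨q, hq1, hq2⟩ := exists_rat_btwn (show t < t + min η η' by
        have := lt_min hη hη'
        linarith)
      have hqη : |(q : ℝ) - t| < min η η' := by
        rw [abs_of_pos (by linarith)]; linarith
      refine ⟨fun j => interpolant T (τ (χ j)) (U (χ j)) q, ?_, ?_⟩
      · obtain ⟨y, hy⟩ := hψQ q (Or.inl (mem_range_self q))
        exact hy.cauchySeq
      · have hDq := h' (x := (q : ℝ)) (hqη.trans_le (min_le_right _ _))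
        rw [Real.dist_eq] at hDq
        have hsub : ∀ᶠ j in atTop, dissipAt T F (τ (χ j)) (U (χ j)) q -
            dissipAt T F (τ (χ j)) (U (χ j)) t < δ / (4 * (M + 1)) :=
          ((hχD q).sub (hχD t)).eventually_lt_const ((le_abs_self _).trans_lt hDq)
        filter_upwards [hχm.tendsto_atTop.eventually h, hsub] with j hj hj'
        have h1 := (hj t q hq1.le (by simpa using hη.le) (hqη.le.trans (min_le_left _ _))).1
        rw [dist_comm, dist_eq_norm]
        rw [lt_div_iff₀ (by positivity)] at hj'
        have h2 := hDm (χ j) hq1.le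
        nlinarith
    · exact hψQ t (Or.inr htD)
  choose! v hv using hlim
  refine ⟨χ, fun t => v (clamp T t), D, hχm, hD, fun t => ?_, hχD⟩
  refine (hv _ (clamp_mem hT.le t)).congr fun j => ?_
  rw [interpolant_eq, interpolant_eq, timeIndex_clamp (hτ _) hT.le]

end Limit

/-! ### One-sided limits, jump costs and energy of the limit curve -/

section LimitCurve

variable {X : Type*} [NormedAddCommGroup X] [InnerProductSpace ℝ X] [FiniteDimensional ℝ X]
  {T : ℝ} {F : ℝ → X → ℝ} {u₀ : X} {ε τ : ℕ → ℝ} {U : ℕ → ℕ → X} {u : ℝ → X} {D : ℝ → ℝ}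

/-- The interpolants of the discrete solutions `U j` and their dissipated energies converge
pointwise to `u` and `D`. -/
structure IsLimit (T : ℝ) (F : ℝ → X → ℝ) (u₀ : X) (ε τ : ℕ → ℝ) (U : ℕ → ℕ → X)
    (u : ℝ → X) (D : ℝ → ℝ) : Prop where
  viscosity_pos : ∀ j, 0 < ε j
  step_pos : ∀ j, 0 < τ j
  viscosity_tendsto : Tendsto ε atTop (𝓝 0)
  step_tendsto : Tendsto τ atTop (𝓝 0)
  ratio_tendsto : Tendsto (fun j => ε j / τ j) atTop atTop
  isDiscreteSolution : ∀ j, IsDiscreteSolution T F u₀ (ε j) (τ j) (U j)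
  monotone : Monotone D
  tendsto_interpolant : ∀ t, Tendsto (fun j => interpolant T (τ j) (U j) t) atTop (𝓝 (u t))
  tendsto_dissipAt : ∀ t, Tendsto (fun j => dissipAt T F (τ j) (U j) t) atTop (𝓝 (D t))

/-- The standing assumptions used to control the limit curve. -/
structure Assumptions (T : ℝ) (F : ℝ → X → ℝ) : Prop where
  pos : 0 < T
  c1 : IsC1 T F
  coercive : IsCoercive T F
  power : PowerControl T F
  isolated : IsolatedCritical T F

omit [InnerProductSpace ℝ X] [FiniteDimensional ℝ X] in
theorem IsLimit.clamp_eq (h : IsLimit T F u₀ ε τ U u D) (hT : 0 < T) (t : ℝ) :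
    u (clamp T t) = u t := by
  refine tendsto_nhds_unique (h.tendsto_interpolant (clamp T t)) ?_
  refine (h.tendsto_interpolant t).congr fun j => ?_
  rw [interpolant_eq, interpolant_eq, timeIndex_clamp (h.step_pos j) hT.le]

theorem IsLimit.bounds (h : IsLimit T F u₀ ε τ U u D) (hA : Assumptions T F) {r : ℝ}
    (hr : r ∈ Icc 0 T) {δ : ℝ} (hδ : 0 < δ) :
    ∃ η > 0, ∃ M ≥ 0, ∀ s t, s ≤ t → |s - r| ≤ η → |t - r| ≤ η →
      ‖u t - u s‖ ≤ δ + M * (D t - D s) ∧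
      lipCost (fun z => ‖gradX F r z‖) (u s) (u t) ≤ δ + (1 + δ) * (D t - D s) := by
  obtain ⟨η, hη, M, hM, hb⟩ := exists_interpolant_bounds hA.pos hA.c1 hA.coercive hA.power
    hA.isolated h.viscosity_pos h.step_pos h.step_tendsto h.ratio_tendsto h.isDiscreteSolution
    hr hδ
  refine ⟨η, hη, M, hM, fun s t hst hs ht => ⟨?_, ?_⟩⟩
  · refine le_of_tendsto_of_tendsto
      ((h.tendsto_interpolant t).sub (h.tendsto_interpolant s)).norm
      ((((h.tendsto_dissipAt t).sub (h.tendsto_dissipAt s)).const_mul M).const_add δ) ?_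
    filter_upwards [hb] with j hj
    exact (hj s t hst hs ht).1
  · refine lipCost_le_of_tendsto (hA.c1.continuous_gradX hA.pos hr).norm (fun _ => norm_nonneg _)
      (h.tendsto_interpolant s) (h.tendsto_interpolant t)
      ((((h.tendsto_dissipAt t).sub (h.tendsto_dissipAt s)).const_mul (1 + δ)).const_add δ) ?_
    filter_upwards [hb] with j hj
    exact (hj s t hst hs ht).2

/-- Where `D` converges its increments are small, so the displacement bound makes `u` Cauchy along
the same filter. -/
theorem IsLimit.exists_tendsto (h : IsLimit T F u₀ ε τ U u D) (hA : Assumptions T F) {r : ℝ}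
    (hr : r ∈ Icc 0 T) {l : Filter ℝ} [l.NeBot] (hl : l ≤ 𝓝 r) {d : ℝ}
    (hd : Tendsto D l (𝓝 d)) : ∃ x, Tendsto u l (𝓝 x) := by
  have : CompleteSpace X := FiniteDimensional.complete ℝ X
  have hc : Cauchy (map u l) := by
    rw [Metric.cauchy_iff]
    refine ⟨inferInstance, fun δ hδ => ?_⟩
    obtain ⟨η, hη, M, hM, hb⟩ := h.bounds hA hr (half_pos hδ)
    set c := δ / (4 * (M + 1)) with hc
    have hc0 : 0 < c := by positivity
    set A := {t : ℝ | |t - r| ≤ η ∧ |D t - d| < c} with hAdef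
    have hAl : A ∈ l := by
      exact inter_mem (hl (Metric.closedBall_mem_nhds r hη)) (hd (Metric.ball_mem_nhds d hc0))
    refine ⟨u '' A, image_mem_map hAl, ?_⟩
    have key : ∀ s ∈ A, ∀ t ∈ A, s ≤ t → dist (u s) (u t) < δ := by
      intro s hs t ht hst
      have h1 := (hb s t hst hs.1 ht.1).1
      have h2 := abs_lt.1 hs.2
      have h3 := abs_lt.1 ht.2
      have h4 : M * (D t - D s) ≤ M * (2 * c) := by
        gcongr
        linarith
      have h5 : (M + 1) * (4 * c) = δ := by rw [hc]; field_simp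
      rw [dist_comm, dist_eq_norm]
      nlinarith
    rintro _ ⟨s, hs, rfl⟩ _ ⟨t, ht, rfl⟩
    rcases le_total s t with hst | hst
    · exact key s hs t ht hst
    · rw [dist_comm]
      exact key t ht s hs hst
  exact cauchy_map_iff_exists_tendsto.1 hc

theorem IsLimit.tendsto_rightLim (h : IsLimit T F u₀ ε τ U u D) (hA : Assumptions T F) {r : ℝ}
    (hr : r ∈ Icc 0 T) : Tendsto u (𝓝[>] r) (𝓝 (Function.rightLim u r)) :=
  tendsto_rightLim_of_tendsto
    (h.exists_tendsto hA hr nhdsWithin_le_nhds (h.monotone.tendsto_rightLim r))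

theorem IsLimit.tendsto_leftLim (h : IsLimit T F u₀ ε τ U u D) (hA : Assumptions T F) {r : ℝ}
    (hr : r ∈ Icc 0 T) : Tendsto u (𝓝[<] r) (𝓝 (Function.leftLim u r)) :=
  tendsto_leftLim_of_tendsto
    (h.exists_tendsto hA hr nhdsWithin_le_nhds (h.monotone.tendsto_leftLim r))

theorem IsLimit.continuousAt (h : IsLimit T F u₀ ε τ U u D) (hA : Assumptions T F) {r : ℝ}
    (hr : r ∈ Icc 0 T) (hD : ContinuousAt D r) : ContinuousAt u r := by
  obtain ⟨x, hx⟩ := h.exists_tendsto hA hr le_rfl hD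
  rwa [← eq_of_tendsto_nhds hx] at hx

/-- The transition bound is applied to s < r < t, with s and t tending to r and then δ to 0. -/
theorem IsLimit.lipCost_le (h : IsLimit T F u₀ ε τ U u D) (hA : Assumptions T F) {r : ℝ}
    (hr : r ∈ Icc 0 T) :
    lipCost (fun z => ‖gradX F r z‖) (Function.leftLim u r) (Function.rightLim u r) ≤
      Function.rightLim D r - Function.leftLim D r := by
  set d := Function.rightLim D r - Function.leftLim D r
  have key : ∀ δ > 0, lipCost (fun z => ‖gradX F r z‖) (Function.leftLim u r)
      (Function.rightLim u r) ≤ δ + (1 + δ) * d := by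
    intro δ hδ
    obtain ⟨η, hη, M, hM, hb⟩ := h.bounds hA hr hδ
    refine lipCost_le_of_tendsto (l := 𝓝[<] r ×ˢ 𝓝[>] r)
      (v := fun p => u p.1) (w := fun p => u p.2)
      (c := fun p => δ + (1 + δ) * (D p.2 - D p.1))
      (hA.c1.continuous_gradX hA.pos hr).norm (fun _ => norm_nonneg _)
      ((h.tendsto_leftLim hA hr).comp tendsto_fst) ((h.tendsto_rightLim hA hr).comp tendsto_snd)
      (((((h.monotone.tendsto_rightLim r).comp tendsto_snd).sub
        ((h.monotone.tendsto_leftLim r).comp tendsto_fst)).const_mul _).const_add _) ?_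
    have e1 : ∀ᶠ s in 𝓝[<] r, s < r ∧ |s - r| ≤ η :=
      inter_mem self_mem_nhdsWithin (nhdsWithin_le_nhds (Metric.closedBall_mem_nhds r hη))
    have e2 : ∀ᶠ s in 𝓝[>] r, r < s ∧ |s - r| ≤ η :=
      inter_mem self_mem_nhdsWithin (nhdsWithin_le_nhds (Metric.closedBall_mem_nhds r hη))
    filter_upwards [e1.prod_mk e2] with p hp
    exact (hb p.1 p.2 (hp.1.1.trans hp.2.1).le hp.1.2 hp.2.2).2
  have hlim : Tendsto (fun δ : ℝ => δ + (1 + δ) * d) (𝓝[>] 0) (𝓝 (0 + (1 + 0) * d)) :=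
    Tendsto.mono_left (Continuous.tendsto (by fun_prop) 0) nhdsWithin_le_nhds
  simp only [zero_add, add_zero, one_mul] at hlim
  exact ge_of_tendsto hlim (eventually_mem_nhdsWithin.mono fun δ hδ => key δ hδ)

omit [InnerProductSpace ℝ X] [FiniteDimensional ℝ X] in
theorem IsLimit.uPlus_eq (h : IsLimit T F u₀ ε τ U u D) (hT : 0 < T) {t : ℝ}
    (ht : t ∈ Icc 0 T) : uPlus T u t = Function.rightLim u t := by
  rw [uPlus]
  split_ifs with hlt
  · rfl
  · have htT : t = T := le_antisymm ht.2 (not_lt.1 hlt)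
    subst htT
    refine (rightLim_eq_of_tendsto
      (tendsto_const_nhds.congr' ?_)).symm
    filter_upwards [self_mem_nhdsWithin] with s hs
    rw [← h.clamp_eq hT s, clamp, min_eq_right (mem_Ioi.1 hs).le, max_eq_right ht.1]

omit [InnerProductSpace ℝ X] [FiniteDimensional ℝ X] in
theorem IsLimit.uMinus_eq (h : IsLimit T F u₀ ε τ U u D) (hT : 0 < T) {t : ℝ}
    (ht : t ∈ Icc 0 T) : uMinus u t = Function.leftLim u t := by
  rw [uMinus]
  split_ifs with hlt
  · rfl
  · have ht0 : t = 0 := le_antisymm (not_lt.1 hlt) ht.1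
    subst ht0
    refine (leftLim_eq_of_tendsto
      (tendsto_const_nhds.congr' ?_)).symm
    filter_upwards [self_mem_nhdsWithin] with s hs
    rw [← h.clamp_eq hT s, clamp, max_eq_left ((min_le_left _ _).trans (mem_Iio.1 hs).le)]

/-! ### The energy identity -/

omit [FiniteDimensional ℝ X] in
theorem IsC1.measurable_dtime (hF0 : IsC1 T F) (hT : 0 < T) (x : X) :
    Measurable fun r => dtime T F r x := by
  have hc : Continuous fun r => dtime T F (clamp T r) x :=
    (hF0.continuousOn_dtime_slice hT x).comp_continuous continuous_clamp
      fun r => clamp_mem hT.le r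
  have he : (fun r => dtime T F r x) = (Icc 0 T).indicator fun r => dtime T F (clamp T r) x := by
    ext r
    by_cases hr : r ∈ Icc 0 T
    · rw [indicator_of_mem hr, clamp_of_mem hr]
    · rw [indicator_of_notMem hr, dtime_of_notMem hr]
  rw [he]
  exact hc.measurable.indicator measurableSet_Icc

/-- The index of the last point of the discrete solution reached before time `t`. -/
noncomputable def lowerIndex (T τ t : ℝ) : ℕ := min ⌊t / τ⌋₊ ⌊T / τ⌋₊

omit [FiniteDimensional ℝ X] in
theorem IsC1.measurable_dtime_lowerIndex (hF0 : IsC1 T F) (hT : 0 < T) (τ : ℝ) (U : ℕ → X) :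
    Measurable fun r => dtime T F r (U (lowerIndex T τ r)) := by
  have h1 : Measurable fun p : ℕ × ℝ => dtime T F p.2 (U p.1) :=
    measurable_from_prod_countable_right fun n => hF0.measurable_dtime hT (U n)
  have h2 : Measurable fun r : ℝ => (lowerIndex T τ r, r) :=
    (((Nat.measurable_floor.comp (measurable_id.div_const τ)).min measurable_const).prodMk
      measurable_id)
  exact h1.comp h2

theorem intervalIntegrable_of_measurable_of_abs_le {f : ℝ → ℝ} (hf : Measurable f) {C : ℝ}
    (hC : ∀ r, |f r| ≤ C) (a b : ℝ) : IntervalIntegrable f volume a b :=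
  (intervalIntegrable_const (c := C)).mono_fun hf.aestronglyMeasurable
    (Eventually.of_forall fun r => (hC r).trans (le_abs_self C))

/-- Between kτ and (k+1)τ the work is done at the old point `U k`, whence the floor instead of the
ceiling of the interpolant. -/
theorem work_eq_integral (hT : 0 < T) (hF0 : IsC1 T F) {τ : ℝ} (hτ : 0 < τ) {U : ℕ → X} {R : ℝ}
    (hR : ∀ k ≤ ⌊T / τ⌋₊, ‖U k‖ ≤ R) {n : ℕ} (hn : n ≤ ⌊T / τ⌋₊) :
    work F τ U n = ∫ r in (0 : ℝ)..n * τ, dtime T F r (U (lowerIndex T τ r)) := by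
  obtain ⟨C, hC0, hC⟩ := hF0.exists_abs_dtime_le hT R
  have hint : ∀ a b, IntervalIntegrable (fun r => dtime T F r (U (lowerIndex T τ r))) volume a b :=
    intervalIntegrable_of_measurable_of_abs_le (hF0.measurable_dtime_lowerIndex hT τ U)
      fun r => hC r _ (hR _ (min_le_right _ _))
  have hsum := intervalIntegral.sum_integral_adjacent_intervals (n := n)
    (a := fun k : ℕ => (k : ℝ) * τ) fun k _ => hint (k * τ) ((k + 1 : ℕ) * τ)
  simp only [Nat.cast_zero, zero_mul] at hsum
  rw [← hsum, work]
  refine Finset.sum_congr rfl fun k hk => ?_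
  have hk' : k + 1 ≤ ⌊T / τ⌋₊ := (Finset.mem_range.1 hk).trans_le hn
  have hle : (k : ℝ) * τ ≤ (k + 1 : ℕ) * τ := by push_cast; nlinarith
  rw [← hF0.integral_dtime hT (by positivity) hle (natCast_mul_mem_Icc hτ hT.le hk').2]
  refine intervalIntegral.integral_congr_on_Ioo hle fun r hr => ?_
  have hfl : ⌊r / τ⌋₊ = k := by
    rw [Nat.floor_eq_iff (div_nonneg ((by positivity : (0 : ℝ) ≤ k * τ).trans hr.1.le) hτ.le),
      le_div_iff₀ hτ, div_lt_iff₀ hτ]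
    exact ⟨hr.1.le, by simpa using hr.2⟩
  rw [lowerIndex, hfl, min_eq_left (by omega)]

theorem IsLimit.exists_norm_le (h : IsLimit T F u₀ ε τ U u D) (hA : Assumptions T F) :
    ∃ R, (∀ j, ∀ k ≤ ⌊T / τ j⌋₊, ‖U j k‖ ≤ R) ∧ ∀ t, ‖u t‖ ≤ R := by
  obtain ⟨R, hR⟩ := exists_norm_discreteSolution_le hA.pos hA.c1 hA.coercive hA.power u₀
  have hR' : ∀ j, ∀ k ≤ ⌊T / τ j⌋₊, ‖U j k‖ ≤ R := fun j =>
    hR _ _ _ (h.viscosity_pos j) (h.step_pos j) (h.isDiscreteSolution j)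
  exact ⟨R, hR', fun t => le_of_tendsto (h.tendsto_interpolant t).norm
    (Eventually.of_forall fun j => hR' j _ (timeIndex_le t))⟩

/-- Floor and ceiling indices differ by at most one step, and steps vanish uniformly. -/
theorem IsLimit.tendsto_lowerIndex (h : IsLimit T F u₀ ε τ U u D) (hA : Assumptions T F) (t : ℝ) :
    Tendsto (fun j => U j (lowerIndex T (τ j) t)) atTop (𝓝 (u t)) := by
  obtain ⟨R, hR, -⟩ := h.exists_norm_le hA
  have h0 : Tendsto (fun j => U j (lowerIndex T (τ j) t) - interpolant T (τ j) (U j) t) atTop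
      (𝓝 0) := by
    rw [Metric.tendsto_nhds]
    intro δ hδ
    filter_upwards [eventually_norm_step_le hA.pos hA.c1 h.viscosity_pos h.step_pos
      h.ratio_tendsto h.isDiscreteSolution hR (half_pos hδ)] with j hj
    rw [dist_zero_right, interpolant_eq]
    have h1 : ⌊t / τ j⌋₊ ≤ ⌈t / τ j⌉₊ := Nat.floor_le_ceil _
    have h2 : ⌈t / τ j⌉₊ ≤ ⌊t / τ j⌋₊ + 1 := Nat.ceil_le_floor_add_one _
    have h3 : timeIndex T (τ j) t = lowerIndex T (τ j) t ∨
        (timeIndex T (τ j) t = lowerIndex T (τ j) t + 1 ∧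
          lowerIndex T (τ j) t + 1 ≤ ⌊T / τ j⌋₊) := by
      simp only [timeIndex, lowerIndex]
      omega
    rcases h3 with h3 | ⟨h3, h4⟩
    · rw [h3, sub_self, norm_zero]
      exact hδ
    · rw [h3, norm_sub_rev]
      exact (hj _ h4).trans_lt (half_lt_self hδ)
  simpa using h0.add (h.tendsto_interpolant t)

omit [FiniteDimensional ℝ X] in
theorem IsC1.continuous_dtime_space (hF0 : IsC1 T F) (hT : 0 < T) (t : ℝ) :
    Continuous (dtime T F t) := by
  by_cases ht : t ∈ Icc 0 T
  · rw [← continuousOn_univ]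
    exact (hF0.continuousOn_dtime hT).comp (f := fun x : X => (t, x)) (by fun_prop)
      fun _ _ => ⟨ht, mem_univ _⟩
  · exact continuous_const.congr fun x => (dtime_of_notMem ht x).symm

theorem IsLimit.tendsto_dtime (h : IsLimit T F u₀ ε τ U u D) (hA : Assumptions T F) (t : ℝ) :
    Tendsto (fun j => dtime T F t (U j (lowerIndex T (τ j) t))) atTop (𝓝 (dtime T F t (u t))) :=
  ((hA.c1.continuous_dtime_space hA.pos t).tendsto _).comp (h.tendsto_lowerIndex hA t)

theorem IsLimit.intervalIntegrable_dtime (h : IsLimit T F u₀ ε τ U u D) (hA : Assumptions T F)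
    (a b : ℝ) : IntervalIntegrable (fun r => dtime T F r (u r)) volume a b := by
  obtain ⟨R, -, hR⟩ := h.exists_norm_le hA
  obtain ⟨C, -, hC⟩ := hA.c1.exists_abs_dtime_le hA.pos R
  refine intervalIntegrable_of_measurable_of_abs_le (measurable_of_tendsto_metrizable
    (fun j => hA.c1.measurable_dtime_lowerIndex hA.pos (τ j) (U j)) ?_) (fun r => hC r _ (hR r)) a b
  exact tendsto_pi_nhds.2 (h.tendsto_dtime hA)

omit [InnerProductSpace ℝ X] [FiniteDimensional ℝ X] in
theorem IsLimit.tendsto_timeIndex (h : IsLimit T F u₀ ε τ U u D) {t : ℝ} (ht : t ∈ Icc 0 T) :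
    Tendsto (fun j => timeIndex T (τ j) t * τ j) atTop (𝓝 t) := by
  rw [tendsto_iff_dist_tendsto_zero]
  exact squeeze_zero (fun _ => dist_nonneg)
    (fun j => abs_timeIndex_mul_sub_le (h.step_pos j) ht) h.step_tendsto

/-- Dominated convergence on [0,t]; the grid time differs from t by at most τ, and the integrand is
bounded. -/
theorem IsLimit.tendsto_work (h : IsLimit T F u₀ ε τ U u D) (hA : Assumptions T F) {t : ℝ}
    (ht : t ∈ Icc 0 T) :
    Tendsto (fun j => work F (τ j) (U j) (timeIndex T (τ j) t)) atTop
      (𝓝 (∫ r in (0 : ℝ)..t, dtime T F r (u r))) := by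
  obtain ⟨R, hR, -⟩ := h.exists_norm_le hA
  obtain ⟨C, hC0, hC⟩ := hA.c1.exists_abs_dtime_le hA.pos R
  have hb : ∀ j r, |dtime T F r (U j (lowerIndex T (τ j) r))| ≤ C := fun j r =>
    hC r _ (hR j _ (min_le_right _ _))
  have hm := fun j => hA.c1.measurable_dtime_lowerIndex hA.pos (τ j) (U j)
  have hint : ∀ j a b, IntervalIntegrable
      (fun r => dtime T F r (U j (lowerIndex T (τ j) r))) volume a b :=
    fun j => intervalIntegrable_of_measurable_of_abs_le (hm j) (hb j)
  have h1 : Tendsto (fun j => ∫ r in (0 : ℝ)..t, dtime T F r (U j (lowerIndex T (τ j) r))) atTop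
      (𝓝 (∫ r in (0 : ℝ)..t, dtime T F r (u r))) :=
    intervalIntegral.tendsto_integral_filter_of_dominated_convergence (fun _ => C)
      (Eventually.of_forall fun j => (hm j).aestronglyMeasurable)
      (Eventually.of_forall fun j => Eventually.of_forall fun r _ => hb j r)
      intervalIntegrable_const (Eventually.of_forall fun r _ => h.tendsto_dtime hA r)
  have h2 : Tendsto (fun j => ∫ r in t..timeIndex T (τ j) t * τ j,
      dtime T F r (U j (lowerIndex T (τ j) r))) atTop (𝓝 0) := by
    refine squeeze_zero_norm (a := fun j => C * τ j) (fun j => ?_) ?_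
    · refine (intervalIntegral.norm_integral_le_of_norm_le_const fun r _ => hb j r).trans ?_
      exact mul_le_mul_of_nonneg_left (abs_timeIndex_mul_sub_le (h.step_pos j) ht) hC0
    · simpa using h.step_tendsto.const_mul C
  have h3 := h1.add h2
  rw [add_zero] at h3
  refine h3.congr fun j => ?_
  rw [work_eq_integral hA.pos hA.c1 (h.step_pos j) (hR j) (timeIndex_le t),
    intervalIntegral.integral_add_adjacent_intervals (hint j _ _) (hint j _ _)]

theorem IsLimit.energy_eq (h : IsLimit T F u₀ ε τ U u D) (hA : Assumptions T F) {t : ℝ}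
    (ht : t ∈ Icc 0 T) :
    F t (u t) = F 0 u₀ + (∫ r in (0 : ℝ)..t, dtime T F r (u r)) - D t := by
  have h1 : Tendsto (fun j => F (timeIndex T (τ j) t * τ j) (interpolant T (τ j) (U j) t)) atTop
      (𝓝 (F t (u t))) := by
    have hc := hA.c1.continuousOn (t, u t) ⟨ht, mem_univ _⟩
    refine Tendsto.comp hc (tendsto_nhdsWithin_iff.2
      ⟨(h.tendsto_timeIndex ht).prodMk_nhds (h.tendsto_interpolant t),
        Eventually.of_forall fun j => ⟨?_, mem_univ _⟩⟩)
    exact natCast_mul_mem_Icc (h.step_pos j) hA.pos.le (timeIndex_le t)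
  refine tendsto_nhds_unique h1 (Tendsto.congr (fun j => ?_)
    (((h.tendsto_work hA ht).const_add (F 0 u₀)).sub (h.tendsto_dissipAt t)))
  exact ((h.isDiscreteSolution j).energy_eq _).symm

end LimitCurve

/-! ### Criticality of the one-sided limits -/

section Critical

variable {X : Type*} [NormedAddCommGroup X] [InnerProductSpace ℝ X] [FiniteDimensional ℝ X]
  {T : ℝ} {F : ℝ → X → ℝ} {u₀ : X} {ε τ : ℕ → ℝ} {U : ℕ → ℕ → X} {u : ℝ → X} {D : ℝ → ℝ}

/-- Otherwise the discrete solution stays, on a time interval of fixed length, where the gradient is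
at least κ. Each step there releases at least τκ²/(2ε), in total more than eκ²/(2ε), contradicting
the bound on the increment of `D` once ε is small. -/
theorem IsLimit.gradX_eq_zero_of_continuousAt (h : IsLimit T F u₀ ε τ U u D)
    (hA : Assumptions T F) {t : ℝ} (ht : t ∈ Ioo 0 T) (hD : ContinuousAt D t) :
    gradX F t (u t) = 0 := by
  by_contra hne
  have htI := Ioo_subset_Icc_self ht
  set κ := ‖gradX F t (u t)‖ / 2 with hκdef
  have hκ : 0 < κ := half_pos (norm_pos_iff.2 hne)
  obtain ⟨ρ, hρ, hG⟩ : ∃ ρ > 0, ∀ s ∈ Icc 0 T, |s - t| < ρ → ∀ y, ‖y - u t‖ < ρ →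
      κ ≤ ‖gradX F s y‖ := by
    have hc := (hA.c1.continuousOn_gradX hA.pos).norm (t, u t) ⟨htI, mem_univ _⟩
    obtain ⟨ρ, hρ, hh⟩ := Metric.continuousWithinAt_iff.1 hc κ hκ
    refine ⟨ρ, hρ, fun s hs hst y hy => ?_⟩
    have := hh (x := (s, y)) ⟨hs, mem_univ _⟩ (by
      rw [Prod.dist_eq, max_lt_iff, Real.dist_eq, dist_eq_norm]
      exact ⟨hst, hy⟩)
    rw [Real.dist_eq, abs_lt] at this
    have h2 : ‖gradX F t (u t)‖ = 2 * κ := by rw [hκdef]; ring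
    simp only [h2] at this
    linarith
  obtain ⟨η, hη, M, hM, hb⟩ := exists_interpolant_bounds hA.pos hA.c1 hA.coercive hA.power
    hA.isolated h.viscosity_pos h.step_pos h.step_tendsto h.ratio_tendsto h.isDiscreteSolution
    htI (show 0 < ρ / 4 by positivity)
  set c := ρ / (8 * (M + 1)) with hcdef
  have hc0 : 0 < c := by positivity
  have hMc : M * (2 * c) ≤ ρ / 4 := by
    have : (M + 1) * (2 * c) = ρ / 4 := by rw [hcdef]; field_simp; norm_num
    nlinarith
  obtain ⟨ζ, hζ, hDζ⟩ := Metric.continuousAt_iff.1 hD c hc0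
  obtain ⟨e, he0, heζ, heη, heρ, he1, he2⟩ : ∃ e > 0, e < ζ ∧ e ≤ η ∧ e < ρ ∧ e ≤ t ∧
      e ≤ T - t := by
    have hpos : 0 < min (min ζ η) (min ρ (min t (T - t))) :=
      lt_min (lt_min hζ hη) (lt_min hρ (lt_min ht.1 (sub_pos.2 ht.2)))
    refine ⟨min (min ζ η) (min ρ (min t (T - t))) / 2, half_pos hpos, ?_⟩
    have h1 : min (min ζ η) (min ρ (min t (T - t))) ≤ ζ := by simp
    have h2 : min (min ζ η) (min ρ (min t (T - t))) ≤ η := by simp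
    have h3 : min (min ζ η) (min ρ (min t (T - t))) ≤ ρ := by simp
    have h4 : min (min ζ η) (min ρ (min t (T - t))) ≤ t := by simp
    have h5 : min (min ζ η) (min ρ (min t (T - t))) ≤ T - t := by simp
    refine ⟨?_, ?_, ?_, ?_, ?_⟩ <;> linarith
  have hDe : D (t + e) - D (t - e) < 2 * c := by
    have h1 := hDζ (x := t + e) (by rw [Real.dist_eq]; simpa [abs_of_pos he0] using heζ)
    have h2 := hDζ (x := t - e) (by rw [Real.dist_eq]; simpa [abs_of_pos he0] using heζ)
    rw [Real.dist_eq, abs_lt] at h1 h2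
    linarith
  have hε2 : Tendsto (fun j => 2 * ε j * (2 * c)) atTop (𝓝 0) := by
    simpa using (h.viscosity_tendsto.const_mul 2).mul_const (2 * c)
  obtain ⟨j, hbj, hDj, huj, hτj, hεj⟩ := (hb.and ((((h.tendsto_dissipAt (t + e)).sub
    (h.tendsto_dissipAt (t - e))).eventually_lt_const hDe).and
    ((Metric.tendsto_nhds.1 (h.tendsto_interpolant t) (ρ / 4) (by positivity)).and
    ((h.step_tendsto.eventually_lt_const (show 0 < e / 4 by positivity)).and
    (hε2.eventually_lt_const (show 0 < e * κ ^ 2 by positivity)))))).exists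
  have hτp := h.step_pos j
  have hεp := h.viscosity_pos j
  have hUj := h.isDiscreteSolution j
  have hDmono := hUj.monotone_dissipAt hεp hτp
  have hclose : ∀ s, t - e ≤ s → s ≤ t + e →
      ‖interpolant T (τ j) (U j) s - u t‖ < ρ := by
    intro s hs1 hs2
    have h1 : ‖interpolant T (τ j) (U j) s - interpolant T (τ j) (U j) t‖ ≤ ρ / 2 := by
      have hinc : ∀ a b, t - e ≤ a → b ≤ t + e → M * (dissipAt T F (τ j) (U j) b -
          dissipAt T F (τ j) (U j) a) ≤ ρ / 4 := fun a b ha hb => by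
        refine le_trans (mul_le_mul_of_nonneg_left ?_ hM) hMc
        have := hDmono ha
        have := hDmono hb
        linarith
      have hsη : |s - t| ≤ η := abs_le.2 ⟨by linarith, by linarith⟩
      have htη : |t - t| ≤ η := by simpa using hη.le
      rcases le_total s t with hst | hst
      · have h2 := (hbj s t hst hsη htη).1
        rw [norm_sub_rev] at h2
        linarith [hinc s t hs1 (by linarith)]
      · linarith [(hbj t s hst htη hsη).1, hinc t s (by linarith) hs2]
    rw [dist_eq_norm] at huj
    have h2 := norm_sub_le_norm_sub_add_norm_sub (interpolant T (τ j) (U j) s)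
      (interpolant T (τ j) (U j) t) (u t)
    linarith
  set m := timeIndex T (τ j) (t - e)
  -- Stopping at t + e/2 keeps the grid times below t + e despite rounding. Since τ < e/4, the grid
  -- interval still has length at least 3e/2 - 2τ > e.
  set n := timeIndex T (τ j) (t + e / 2)
  have hmn : m ≤ n := timeIndex_mono hτp (by linarith)
  have hm := abs_le.1 (abs_timeIndex_mul_sub_le (T := T) hτp (t := t - e)
    ⟨by linarith, by linarith⟩)
  have hn := abs_le.1 (abs_timeIndex_mul_sub_le (T := T) hτp (t := t + e / 2)
    ⟨by linarith, by linarith⟩)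
  have hdrop : ∀ k ∈ Finset.Ico m n, τ j / (2 * ε j) * κ ^ 2 ≤ drop F (τ j) (U j) k := by
    intro k hk
    obtain ⟨hk1, hk2⟩ := Finset.mem_Ico.1 hk
    have hkT : k + 1 ≤ ⌊T / τ j⌋₊ := hk2.trans_le (timeIndex_le _)
    refine le_trans ?_ (hUj.sq_norm_gradX_le_drop hA.c1 hA.pos hεp hτp hkT)
    have h1 : (m : ℝ) * τ j + τ j ≤ (k + 1 : ℕ) * τ j := by
      have : (m : ℝ) + 1 ≤ (k + 1 : ℕ) := by exact_mod_cast Nat.succ_le_succ hk1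
      nlinarith
    have h2 : ((k + 1 : ℕ) : ℝ) * τ j ≤ n * τ j := by
      have : ((k + 1 : ℕ) : ℝ) ≤ n := by exact_mod_cast hk2
      gcongr
    have h3 := hclose ((k + 1 : ℕ) * τ j) (by linarith) (by linarith)
    rw [interpolant_eq, timeIndex_natCast_mul hτp hkT] at h3
    have h4 := hG _ (natCast_mul_mem_Icc hτp hA.pos.le hkT)
      (abs_lt.2 ⟨by linarith, by linarith⟩) _ h3
    gcongr
  have hsum := Finset.card_nsmul_le_sum _ _ _ hdrop
  rw [Finset.sum_Ico_eq_sub _ hmn, Nat.card_Ico, nsmul_eq_mul, Nat.cast_sub hmn] at hsum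
  have hup : ∑ k ∈ Finset.range n, drop F (τ j) (U j) k -
      ∑ k ∈ Finset.range m, drop F (τ j) (U j) k < 2 * c := by
    have h1 : dissipAt T F (τ j) (U j) (t + e / 2) ≤ dissipAt T F (τ j) (U j) (t + e) :=
      hDmono (by linarith)
    change dissipAt T F (τ j) (U j) (t + e / 2) - dissipAt T F (τ j) (U j) (t - e) < 2 * c
    linarith
  have hfin := hsum.trans_lt hup
  have h5 : ((n : ℝ) - m) * (τ j / (2 * ε j) * κ ^ 2) =
      (n * τ j - m * τ j) * κ ^ 2 / (2 * ε j) := by field_simp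
  rw [h5, div_lt_iff₀ (by positivity)] at hfin
  have h6 : e * κ ^ 2 ≤ (n * τ j - m * τ j) * κ ^ 2 := by
    gcongr
    linarith
  linarith

theorem _root_.Monotone.frequently_continuousAt_nhdsGT {D : ℝ → ℝ} (hD : Monotone D) (r : ℝ) :
    ∃ᶠ s in 𝓝[>] r, ContinuousAt D s := by
  rw [frequently_iff]
  intro A hA
  obtain ⟨b, hb, hbA⟩ := (mem_nhdsGT_iff_exists_Ioo_subset).1 hA
  obtain ⟨s, hs, hs'⟩ := (hD.countable_not_continuousAt.dense_compl ℝ).exists_between hb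
  exact ⟨s, hbA hs', not_not.1 hs⟩

theorem _root_.Monotone.frequently_continuousAt_nhdsLT {D : ℝ → ℝ} (hD : Monotone D) (r : ℝ) :
    ∃ᶠ s in 𝓝[<] r, ContinuousAt D s := by
  rw [frequently_iff]
  intro A hA
  obtain ⟨b, hb, hbA⟩ := (mem_nhdsLT_iff_exists_Ioo_subset).1 hA
  obtain ⟨s, hs, hs'⟩ := (hD.countable_not_continuousAt.dense_compl ℝ).exists_between hb
  exact ⟨s, hbA hs', not_not.1 hs⟩

/-- Continuity points of `D` occur frequently along the filter and are critical there; the joint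
continuity of the gradient does the rest. -/
theorem IsLimit.gradX_eq_zero_of_tendsto (h : IsLimit T F u₀ ε τ U u D) (hA : Assumptions T F)
    {r : ℝ} (hr : r ∈ Icc 0 T) {l : Filter ℝ} (hl : l ≤ 𝓝 r) (hlI : ∀ᶠ s in l, s ∈ Ioo 0 T)
    (hc : ∃ᶠ s in l, ContinuousAt D s) {x : X} (hx : Tendsto u l (𝓝 x)) : gradX F r x = 0 := by
  have hlim : Tendsto (fun s => gradX F s (u s)) l (𝓝 (gradX F r x)) := by
    have hcon := hA.c1.continuousOn_gradX hA.pos (r, x) ⟨hr, mem_univ _⟩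
    exact Tendsto.comp (f := fun s => (s, u s)) hcon (tendsto_nhdsWithin_iff.2
      ⟨(tendsto_id.mono_left hl).prodMk_nhds hx,
        hlI.mono fun s hs => ⟨Ioo_subset_Icc_self hs, mem_univ _⟩⟩)
  have hfr : ∃ᶠ s in l, gradX F s (u s) ∈ ({0} : Set X) :=
    (hc.and_eventually hlI).mono fun s hs => h.gradX_eq_zero_of_continuousAt hA hs.2 hs.1
  exact isClosed_singleton.mem_of_frequently_of_tendsto hfr hlim

theorem IsLimit.gradX_rightLim (h : IsLimit T F u₀ ε τ U u D) (hA : Assumptions T F)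
    {r : ℝ} (hr : r ∈ Ico 0 T) : gradX F r (Function.rightLim u r) = 0 :=
  h.gradX_eq_zero_of_tendsto hA (Ico_subset_Icc_self hr) nhdsWithin_le_nhds
    (by filter_upwards [Ioo_mem_nhdsGT hr.2] with s hs using ⟨hr.1.trans_lt hs.1, hs.2⟩)
    (h.monotone.frequently_continuousAt_nhdsGT r)
    (h.tendsto_rightLim hA (Ico_subset_Icc_self hr))

theorem IsLimit.gradX_leftLim (h : IsLimit T F u₀ ε τ U u D) (hA : Assumptions T F)
    {r : ℝ} (hr : r ∈ Ioc 0 T) : gradX F r (Function.leftLim u r) = 0 :=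
  h.gradX_eq_zero_of_tendsto hA (Ioc_subset_Icc_self hr) nhdsWithin_le_nhds
    (by filter_upwards [Ioo_mem_nhdsLT hr.1] with s hs using ⟨hs.1, hs.2.trans_le hr.2⟩)
    (h.monotone.frequently_continuousAt_nhdsLT r)
    (h.tendsto_leftLim hA (Ioc_subset_Icc_self hr))

end Critical

/-! ### Monotone functions without diffuse part -/

section JumpFunction

/-- The Stieltjes measure of a monotone function whose right-continuous version has vanishing right
derivative everywhere is concentrated on the jumps. -/
theorem _root_.Monotone.stieltjes_measure_diff_eq_zero {D : ℝ → ℝ} (hD : Monotone D) {a b : ℝ}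
    (hab : a ≤ b) {J : Set ℝ} (hJ : J.Countable)
    (hcont : ∀ r ∈ Icc a b, r ∉ J → Function.leftLim D r = Function.rightLim D r)
    (hderiv : ∀ t ∈ Ico a b, ∀ c > 0, ∀ᶠ t' in 𝓝[>] t,
      Function.rightLim D t' - Function.rightLim D t ≤ c * (t' - t)) :
    hD.stieltjesFunction.measure (Icc a b \ J) = 0 := by
  set ν := hD.stieltjesFunction.measure with hν
  have hJm : MeasurableSet J := hJ.measurableSet
  have hsing : ∀ r ∈ Icc a b, ν.restrict Jᶜ {r} = 0 := by
    intro r hr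
    rw [Measure.restrict_apply (measurableSet_singleton r)]
    by_cases hrJ : r ∈ J
    · have : ({r} : Set ℝ) ∩ Jᶜ = ∅ := by
        ext s
        simp only [mem_inter_iff, mem_singleton_iff, mem_compl_iff, mem_empty_iff_false,
          iff_false, not_and, not_not]
        rintro rfl
        exact hrJ
      rw [this, measure_empty]
    · refine measure_mono_null inter_subset_left ?_
      rw [hν, StieltjesFunction.measure_singleton, ENNReal.ofReal_eq_zero]
      have h1 : Function.leftLim hD.stieltjesFunction r = Function.leftLim D r :=
        leftLim_rightLim (hD.tendsto_leftLim r)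
      rw [h1, hD.stieltjesFunction_eq, hcont r hr hrJ, sub_self]
  -- The distribution function of the measure off `J`. It is continuous because no atoms are left,
  -- and its right derivative vanishes by `hderiv`, so it is constant.
  set f : ℝ → ℝ := fun t => ∫ _ in a..t, (1 : ℝ) ∂(ν.restrict Jᶜ) with hf
  have hint : ∀ s t, IntervalIntegrable (fun _ : ℝ => (1 : ℝ)) (ν.restrict Jᶜ) s t :=
    fun s t => intervalIntegrable_const
  have hfsub : ∀ s t, s ≤ t → f t - f s = (ν.restrict Jᶜ).real (Ioc s t) := by
    intro s t hst
    rw [hf]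
    simp only
    rw [intervalIntegral.integral_interval_sub_left (hint a t) (hint a s),
      intervalIntegral.integral_of_le hst]
    simp
  have hfcont : ContinuousOn f (Icc a b) := fun t ht =>
    intervalIntegral.continuousWithinAt_primitive (hsing t ht) (hint _ _)
  have hfd : ∀ t ∈ Ico a b, HasDerivWithinAt f 0 (Ici t) t := by
    intro t ht
    rw [hasDerivWithinAt_iff_isLittleO, Asymptotics.isLittleO_iff]
    intro c hc
    rw [← Ioi_insert, nhdsWithin_insert, eventually_sup]
    refine ⟨by simp, ?_⟩
    filter_upwards [hderiv t ht c hc, self_mem_nhdsWithin] with t' h1 h2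
    have h2' : t < t' := h2
    rw [smul_zero, sub_zero, hfsub t t' h2'.le, Real.norm_of_nonneg measureReal_nonneg,
      Real.norm_of_nonneg (by linarith)]
    refine le_trans ?_ h1
    have h3 : (ν.restrict Jᶜ).real (Ioc t t') ≤ ν.real (Ioc t t') := by
      exact ENNReal.toReal_mono measure_Ioc_lt_top.ne (Measure.restrict_apply_le _ _)
    refine h3.trans (le_of_eq ?_)
    rw [measureReal_def, hν, StieltjesFunction.measure_Ioc, hD.stieltjesFunction_eq,
      hD.stieltjesFunction_eq, ENNReal.toReal_ofReal]
    exact sub_nonneg.2 (hD.rightLim h2'.le)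
  have hconst := constant_of_has_deriv_right_zero hfcont hfd b ⟨hab, le_rfl⟩
  have hIoc : (ν.restrict Jᶜ) (Ioc a b) = 0 := by
    have h1 := hfsub a b hab
    rw [hconst, sub_self] at h1
    have hne : (ν.restrict Jᶜ) (Ioc a b) ≠ ⊤ := measure_Ioc_lt_top.ne
    exact (measureReal_eq_zero_iff hne).1 h1.symm
  have hIcc : (ν.restrict Jᶜ) (Icc a b) = 0 := by
    rw [← Ioc_insert_left hab, insert_eq]
    exact measure_union_null (hsing a ⟨le_rfl, hab⟩) hIoc
  rwa [Measure.restrict_apply measurableSet_Icc, ← sdiff_eq] at hIcc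

end JumpFunction

/-! ### Jump costs and the energy balance -/

section Balance

variable {X : Type*} [NormedAddCommGroup X] [InnerProductSpace ℝ X] [FiniteDimensional ℝ X]
  {T : ℝ} {F : ℝ → X → ℝ} {u₀ : X} {ε τ : ℕ → ℝ} {U : ℕ → ℕ → X} {u : ℝ → X} {D : ℝ → ℝ}

omit [InnerProductSpace ℝ X] [FiniteDimensional ℝ X] in
theorem IsLimit.dissip_clamp_eq (h : IsLimit T F u₀ ε τ U u D) (hT : 0 < T) (t : ℝ) :
    D (clamp T t) = D t := by
  refine tendsto_nhds_unique (h.tendsto_dissipAt (clamp T t)) ?_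
  refine (h.tendsto_dissipAt t).congr fun j => ?_
  rw [dissipAt, dissipAt, timeIndex_clamp (h.step_pos j) hT.le]

theorem IsLimit.energy_eq_of_tendsto (h : IsLimit T F u₀ ε τ U u D) (hA : Assumptions T F) {r : ℝ}
    (hr : r ∈ Icc 0 T) {l : Filter ℝ} [l.NeBot] (hl : l ≤ 𝓝 r) {x : X} {d : ℝ}
    (hx : Tendsto u l (𝓝 x)) (hd : Tendsto D l (𝓝 d)) :
    F r x = F 0 u₀ + (∫ s in (0 : ℝ)..r, dtime T F s (u s)) - d := by
  have hcl : Tendsto (clamp T) l (𝓝 r) := by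
    have := (continuous_clamp (T := T)).tendsto r
    rw [clamp_of_mem hr] at this
    exact this.mono_left hl
  have h1 : Tendsto (fun t => F (clamp T t) (u t)) l (𝓝 (F r x)) :=
    Tendsto.comp (f := fun t => (clamp T t, u t)) (hA.c1.continuousOn (r, x) ⟨hr, mem_univ _⟩)
      (tendsto_nhdsWithin_iff.2 ⟨hcl.prodMk_nhds hx,
        Eventually.of_forall fun t => ⟨clamp_mem hA.pos.le t, mem_univ _⟩⟩)
  have h2 : Tendsto (fun t => ∫ s in (0 : ℝ)..clamp T t, dtime T F s (u s)) l
      (𝓝 (∫ s in (0 : ℝ)..r, dtime T F s (u s))) :=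
    ((intervalIntegral.continuous_primitive (h.intervalIntegrable_dtime hA) 0).tendsto r).comp hcl
  refine tendsto_nhds_unique h1 (((h2.const_add (F 0 u₀)).sub hd).congr fun t => ?_)
  rw [← h.clamp_eq hA.pos t, ← h.dissip_clamp_eq hA.pos t, h.energy_eq hA (clamp_mem hA.pos.le t)]

theorem IsLimit.energy_rightLim (h : IsLimit T F u₀ ε τ U u D) (hA : Assumptions T F) {r : ℝ}
    (hr : r ∈ Icc 0 T) : F r (Function.rightLim u r) =
      F 0 u₀ + (∫ s in (0 : ℝ)..r, dtime T F s (u s)) - Function.rightLim D r :=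
  h.energy_eq_of_tendsto hA hr nhdsWithin_le_nhds (h.tendsto_rightLim hA hr)
    (h.monotone.tendsto_rightLim r)

theorem IsLimit.energy_leftLim (h : IsLimit T F u₀ ε τ U u D) (hA : Assumptions T F) {r : ℝ}
    (hr : r ∈ Icc 0 T) : F r (Function.leftLim u r) =
      F 0 u₀ + (∫ s in (0 : ℝ)..r, dtime T F s (u s)) - Function.leftLim D r :=
  h.energy_eq_of_tendsto hA hr nhdsWithin_le_nhds (h.tendsto_leftLim hA hr)
    (h.monotone.tendsto_leftLim r)

/-- The one-sided energy identities share the same integral, so the jump of `D` is the energy drop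
at the fixed time r, which the chain rule bounds by the cost. -/
theorem IsLimit.cost_eq (h : IsLimit T F u₀ ε τ U u D) (hA : Assumptions T F) {r : ℝ}
    (hr : r ∈ Icc 0 T) : cost F r (Function.leftLim u r) (Function.rightLim u r) =
      Function.rightLim D r - Function.leftLim D r := by
  refine le_antisymm ((cost_le_lipCost (hA.c1.continuous_gradX hA.pos hr) _ _).trans
    (h.lipCost_le hA hr)) ?_
  have h1 := hA.c1.sub_le_cost hA.pos hr (Function.leftLim u r) (Function.rightLim u r)
  rw [h.energy_leftLim hA hr, h.energy_rightLim hA hr] at h1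
  linarith

omit [InnerProductSpace ℝ X] [FiniteDimensional ℝ X] in
theorem IsLimit.mem_jumpSet_iff (h : IsLimit T F u₀ ε τ U u D) (hT : 0 < T) {r : ℝ} :
    r ∈ jumpSet T u ↔ r ∈ Icc 0 T ∧ Function.leftLim u r ≠ Function.rightLim u r := by
  constructor
  · rintro ⟨hr, hne⟩
    rw [h.uMinus_eq hT hr, h.uPlus_eq hT hr] at hne
    exact ⟨hr, hne⟩
  · rintro ⟨hr, hne⟩
    refine ⟨hr, ?_⟩
    rwa [h.uMinus_eq hT hr, h.uPlus_eq hT hr]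

theorem IsLimit.countable_jumpSet (h : IsLimit T F u₀ ε τ U u D) (hA : Assumptions T F) :
    (jumpSet T u).Countable := by
  refine h.monotone.countable_not_continuousAt.mono ?_
  intro r hr hc
  obtain ⟨hr, hne⟩ := (h.mem_jumpSet_iff hA.pos).1 hr
  have hu := h.continuousAt hA hr hc
  exact hne ((leftLim_eq_of_tendsto (hu.tendsto.mono_left nhdsWithin_le_nhds)).trans
    (rightLim_eq_of_tendsto (hu.tendsto.mono_left nhdsWithin_le_nhds)).symm)

/-- By (F3) the gradient is nonzero at nearby points other than x, so the quotient in (F4) can be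
multiplied out. -/
theorem LiminfCondition.eventually_ge (hF3 : IsolatedCritical T F)
    (hF4 : LiminfCondition T F) {t : ℝ} (ht : t ∈ Icc 0 T) {x : X} (hx : gradX F t x = 0)
    {ρ : ℝ} (hρ : 0 < ρ) : ∀ᶠ v in 𝓝 x, -ρ * ‖gradX F t v‖ ≤ F t v - F t x := by
  have h1 := hF4 t ht x hx
  have h2 : ((-ρ : ℝ) : EReal) < liminf
      (fun v => (((F t v - F t x) / ‖gradX F t v‖ : ℝ) : EReal)) (𝓝[≠] x) :=
    lt_of_lt_of_le (by exact_mod_cast neg_lt_zero.2 hρ) h1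
  have h3 := (eventually_lt_of_lt_liminf h2).and (hF3 t ht x hx)
  rw [eventually_nhdsWithin_iff] at h3
  filter_upwards [h3] with v hv
  by_cases hvx : v = x
  · subst hvx
    rw [hx, norm_zero, mul_zero, sub_self]
  · obtain ⟨h4, h5⟩ := hv hvx
    have h6 : 0 < ‖gradX F t v‖ := norm_pos_iff.2 h5
    have h7 : -ρ < (F t v - F t x) / ‖gradX F t v‖ := by exact_mod_cast h4
    rw [lt_div_iff₀ h6] at h7
    exact h7.le

/-- With x = u₊(t) and v = u₊(t'), the increment of `D` is ∫(∂ₜF(s,u(s)) - ∂ₜF(s,v)) ds + F(t,x) -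
F(t,v). The integral is o(t' - t) because u(s) and v are both close to x. The rest is at most a
small multiple of ‖∇F(t,v)‖ by (F4). -/
theorem IsLimit.rightLim_sub_le (h : IsLimit T F u₀ ε τ U u D) (hA : Assumptions T F)
    (hF4 : LiminfCondition T F) (hF5 : GradLipschitzInTime T F) {t : ℝ} (ht : t ∈ Ico 0 T)
    {c : ℝ} (hc : 0 < c) : ∀ᶠ t' in 𝓝[>] t,
      Function.rightLim D t' - Function.rightLim D t ≤ c * (t' - t) := by
  have htI := Ico_subset_Icc_self ht
  set x := Function.rightLim u t with hxdef
  have hx : gradX F t x = 0 := h.gradX_rightLim hA ht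
  have hux : Tendsto u (𝓝[>] t) (𝓝 x) := h.tendsto_rightLim hA htI
  have hvx : Tendsto (Function.rightLim u) (𝓝[>] t) (𝓝 x) :=
    (continuousWithinAt_rightLim_Ici hux).mono_left (nhdsWithin_mono _ Ioi_subset_Ici_self)
  obtain ⟨L, hL⟩ := hF5 x
  have hρ : 0 < c / (2 * (L + 1)) := by positivity
  obtain ⟨η, hη, hQ⟩ : ∃ η > 0, ∀ s ∈ Icc 0 T, |s - t| < η → ∀ y, ‖y - x‖ < η →
      |dtime T F s y - dtime T F t x| < c / 4 := by
    obtain ⟨η, hη, hh⟩ := Metric.continuousWithinAt_iff.1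
      (hA.c1.continuousOn_dtime hA.pos (t, x) ⟨htI, mem_univ _⟩) (c / 4) (by positivity)
    refine ⟨η, hη, fun s hs hst y hy => ?_⟩
    have := hh (x := (s, y)) ⟨hs, mem_univ _⟩ (by
      rw [Prod.dist_eq, max_lt_iff, Real.dist_eq, dist_eq_norm]
      exact ⟨hst, hy⟩)
    rwa [Real.dist_eq] at this
  obtain ⟨b, hb, hub⟩ := mem_nhdsGT_iff_exists_Ioo_subset.1 (hux (Metric.ball_mem_nhds x hη))
  have hb' : t < b := hb
  have hmin : t < min (min b T) (t + η) := lt_min (lt_min hb' ht.2) (by linarith)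
  filter_upwards [hvx.eventually (hF4.eventually_ge hA.isolated htI hx hρ),
    hvx.eventually hL, hvx.eventually (Metric.ball_mem_nhds x hη), Ioo_mem_nhdsGT hmin]
    with t' h1 h2 h3 h4
  obtain ⟨ht', h4⟩ := h4
  rw [lt_min_iff, lt_min_iff] at h4
  obtain ⟨⟨hb4, hT4⟩, hη4⟩ := h4
  have ht'I : t' ∈ Icc 0 T := ⟨ht.1.trans ht'.le, hT4.le⟩
  set v := Function.rightLim u t'
  have hv0 : gradX F t' v = 0 := h.gradX_rightLim hA ⟨ht'I.1, hT4⟩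
  have e1 := h.energy_rightLim hA htI
  have e2 := h.energy_rightLim hA ht'I
  have hint := h.intervalIntegrable_dtime hA
  have e3 : (∫ s in (0 : ℝ)..t', dtime T F s (u s)) - ∫ s in (0 : ℝ)..t, dtime T F s (u s) =
      ∫ s in t..t', dtime T F s (u s) :=
    intervalIntegral.integral_interval_sub_left (hint _ _) (hint _ _)
  have e4 := hA.c1.integral_dtime hA.pos ht.1 ht'.le hT4.le v
  have hintv : IntervalIntegrable (fun s => dtime T F s v) volume t t' := by
    refine ContinuousOn.intervalIntegrable ?_
    rw [uIcc_of_le ht'.le]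
    exact (hA.c1.continuousOn_dtime_slice hA.pos v).mono (Icc_subset_Icc ht.1 hT4.le)
  have e5 : (∫ s in t..t', dtime T F s (u s)) - ∫ s in t..t', dtime T F s v ≤
      c / 2 * (t' - t) := by
    rw [← intervalIntegral.integral_sub (hint _ _) hintv]
    refine (Real.le_norm_self _).trans ?_
    have := intervalIntegral.norm_integral_le_of_norm_le_const (a := t) (b := t')
      (f := fun s => dtime T F s (u s) - dtime T F s v) (C := c / 2) ?_
    · rwa [abs_of_pos (sub_pos.2 ht')] at this
    · intro s hs
      rw [uIoc_of_le ht'.le] at hs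
      have hsI : s ∈ Icc 0 T := ⟨ht.1.trans hs.1.le, hs.2.trans hT4.le⟩
      have hst : |s - t| < η := by
        rw [abs_of_pos (sub_pos.2 hs.1)]
        linarith [hs.2]
      have hus : ‖u s - x‖ < η := by
        have : s ∈ u ⁻¹' Metric.ball x η := hub ⟨hs.1, hs.2.trans_lt hb4⟩
        rwa [mem_preimage, Metric.mem_ball, dist_eq_norm] at this
      rw [dist_eq_norm] at h3
      have q1 := abs_lt.1 (hQ s hsI hst (u s) hus)
      have q2 := abs_lt.1 (hQ s hsI hst v h3)
      exact abs_le.2 ⟨by linarith, by linarith⟩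
  -- As v is critical at time t', (F5) makes its gradient at time t at most L(t' - t).
  have e6 : ‖gradX F t v‖ ≤ L * (t' - t) := by
    have := h2.dist_le_mul t htI t' ht'I
    rwa [hv0, dist_zero_right, dist_comm, Real.dist_eq, abs_of_pos (sub_pos.2 ht')] at this
  have e7 : c / (2 * (L + 1)) * ‖gradX F t v‖ ≤ c / 2 * (t' - t) := by
    refine (mul_le_mul_of_nonneg_left e6 hρ.le).trans ?_
    have h8 : c / (2 * ((L : ℝ) + 1)) * (L * (t' - t)) =
        c / 2 * (t' - t) * (L / (L + 1)) := by field_simp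
    rw [h8]
    have h9 : (L : ℝ) / (L + 1) ≤ 1 := by
      rw [div_le_one (by positivity)]
      linarith
    exact mul_le_of_le_one_right (mul_nonneg (by positivity) (sub_pos.2 ht').le) h9
  linarith

/-- Each cost is an atom of the Stieltjes measure of `D`, and the jump set carries all its mass in
[0,T]; the atoms in [s,t] therefore sum to the measure of [s,t]. -/
theorem IsLimit.hasSum_cost (h : IsLimit T F u₀ ε τ U u D) (hA : Assumptions T F)
    (hF4 : LiminfCondition T F) (hF5 : GradLipschitzInTime T F) {s t : ℝ} (hs : 0 ≤ s)
    (hst : s ≤ t) (ht : t ≤ T) :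
    HasSum (fun r : ↥(jumpSet T u ∩ Icc s t) => cost F r (uMinus u r) (uPlus T u r))
      (Function.rightLim D t - Function.leftLim D s) := by
  have hI : Icc s t ⊆ Icc 0 T := Icc_subset_Icc hs ht
  set ν := h.monotone.stieltjesFunction.measure with hν
  have hleft : ∀ r, Function.leftLim h.monotone.stieltjesFunction r = Function.leftLim D r :=
    fun r => leftLim_rightLim (h.monotone.tendsto_leftLim r)
  have hJ := h.countable_jumpSet hA
  have hnull : ν (Icc 0 T \ jumpSet T u) = 0 := by
    refine h.monotone.stieltjes_measure_diff_eq_zero hA.pos.le hJ (fun r hr hrJ => ?_)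
      fun r hr c hc => h.rightLim_sub_le hA hF4 hF5 hr hc
    have heq : Function.leftLim u r = Function.rightLim u r := by
      by_contra hne
      exact hrJ ((h.mem_jumpSet_iff hA.pos).2 ⟨hr, hne⟩)
    have h1 := h.energy_leftLim hA hr
    rw [heq, h.energy_rightLim hA hr] at h1
    linarith
  have hcost : ∀ r : ↥(jumpSet T u ∩ Icc s t),
      cost F r (uMinus u r) (uPlus T u r) = (ν {(r : ℝ)}).toReal := by
    rintro ⟨r, hrJ, hr⟩
    rw [h.uMinus_eq hA.pos (hI hr), h.uPlus_eq hA.pos (hI hr), h.cost_eq hA (hI hr), hν,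
      StieltjesFunction.measure_singleton, hleft, h.monotone.stieltjesFunction_eq,
      ENNReal.toReal_ofReal (sub_nonneg.2 (h.monotone.leftLim_le_rightLim le_rfl))]
  have hsum : ∑' r : ↥(jumpSet T u ∩ Icc s t), ν {(r : ℝ)} =
      ENNReal.ofReal (Function.rightLim D t - Function.leftLim D s) := by
    rw [← measure_biUnion (hJ.mono inter_subset_left)
      (fun a _ b _ hab => disjoint_singleton.2 hab) (fun _ _ => measurableSet_singleton _),
      biUnion_of_singleton, ← h.monotone.stieltjesFunction_eq, ← hleft,
      ← StieltjesFunction.measure_Icc, ← hν, inter_comm]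
    have h0 : ν (Icc s t \ jumpSet T u) = 0 :=
      measure_mono_null (sdiff_subset_sdiff_left hI) hnull
    have h1 := measure_inter_add_sdiff (μ := ν) (Icc s t) hJ.measurableSet
    rwa [h0, add_zero] at h1
  have hne : ∑' r : ↥(jumpSet T u ∩ Icc s t), ν {(r : ℝ)} ≠ ⊤ := by
    rw [hsum]
    exact ENNReal.ofReal_ne_top
  have hfin := (ENNReal.summable_toReal hne).hasSum
  rw [← ENNReal.tsum_toReal_eq (fun r => ENNReal.ne_top_of_tsum_ne_top hne r), hsum,
    ENNReal.toReal_ofReal (sub_nonneg.2 (h.monotone.leftLim_le_rightLim hst))] at hfin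
  exact hfin.congr_fun hcost

end Balance

end MinMov

/-! ### Assembly of the theorem -/

theorem mainTheorem1 {X : Type*} [NormedAddCommGroup X] [InnerProductSpace ℝ X]
    [FiniteDimensional ℝ X] [Nontrivial X]
    (T : ℝ) (hT : 0 < T) (F : ℝ → X → ℝ)
    (hF0 : MinMov.IsC1 T F) (hF1 : MinMov.IsCoercive T F) (hF2 : MinMov.PowerControl T F)
    (hF3 : MinMov.IsolatedCritical T F) (hF4 : MinMov.LiminfCondition T F)
    (hF5 : MinMov.GradLipschitzInTime T F)
    (u₀ : X) (ε τ : ℕ → ℝ) (hε : ∀ j, 0 < ε j) (hτ : ∀ j, 0 < τ j)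
    (hε0 : Tendsto ε atTop (𝓝 0)) (hτ0 : Tendsto τ atTop (𝓝 0))
    (hετ : Tendsto (fun j => ε j / τ j) atTop atTop)
    (U : ℕ → ℕ → X) (hU : ∀ j, MinMov.IsDiscreteSolution T F u₀ (ε j) (τ j) (U j)) :
    ∃ (φ : ℕ → ℕ) (u : ℝ → X), StrictMono φ ∧
      (∀ t ∈ Icc 0 T,
        Tendsto (fun j => MinMov.interpolant T (τ (φ j)) (U (φ j)) t) atTop (𝓝 (u t))) ∧
      MinMov.IsRegulated T u ∧
      (∀ t ∈ Ico 0 T, MinMov.gradX F t (MinMov.uPlus T u t) = 0) ∧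
      (∀ t ∈ Ioc 0 T, MinMov.gradX F t (MinMov.uMinus u t) = 0) ∧
      ∀ s t : ℝ, 0 ≤ s → s ≤ t → t ≤ T →
        Summable (fun r : ↥(MinMov.jumpSet T u ∩ Icc s t) =>
          MinMov.cost F r (MinMov.uMinus u r) (MinMov.uPlus T u r)) ∧
        IntervalIntegrable (fun r => MinMov.dtime T F r (u r)) volume s t ∧
        F t (MinMov.uPlus T u t) +
            ∑' r : ↥(MinMov.jumpSet T u ∩ Icc s t),
              MinMov.cost F r (MinMov.uMinus u r) (MinMov.uPlus T u r) =
          F s (MinMov.uMinus u s) + ∫ r in s..t, MinMov.dtime T F r (u r) := by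
  have hA : MinMov.Assumptions T F := ⟨hT, hF0, hF1, hF2, hF3⟩
  obtain ⟨φ, u, D, hφ, hD, hu, hDlim⟩ :=
    MinMov.exists_limit hT hF0 hF1 hF2 hF3 hε hτ hτ0 hετ hU
  have h : MinMov.IsLimit T F u₀ (ε ∘ φ) (τ ∘ φ) (U ∘ φ) u D :=
    ⟨fun j => hε _, fun j => hτ _, hε0.comp hφ.tendsto_atTop, hτ0.comp hφ.tendsto_atTop,
      hετ.comp hφ.tendsto_atTop, fun j => hU _, hD, hu, hDlim⟩
  refine ⟨φ, u, hφ, fun t _ => hu t,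
    ⟨fun t ht => ⟨_, h.tendsto_rightLim hA (Ico_subset_Icc_self ht)⟩,
      fun t ht => ⟨_, h.tendsto_leftLim hA (Ioc_subset_Icc_self ht)⟩⟩,
    fun t ht => ?_, fun t ht => ?_, fun s t hs hst ht => ?_⟩
  · rw [h.uPlus_eq hT (Ico_subset_Icc_self ht)]
    exact h.gradX_rightLim hA ht
  · rw [h.uMinus_eq hT (Ioc_subset_Icc_self ht)]
    exact h.gradX_leftLim hA ht
  · have hsum := h.hasSum_cost hA hF4 hF5 hs hst ht
    have hint := h.intervalIntegrable_dtime hA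
    refine ⟨hsum.summable, hint s t, ?_⟩
    have hsI : s ∈ Icc 0 T := ⟨hs, hst.trans ht⟩
    have htI : t ∈ Icc 0 T := ⟨hs.trans hst, ht⟩
    -- The balance is the difference of the right energy identity at t and the left one at s.
    rw [hsum.tsum_eq, h.uPlus_eq hT htI, h.uMinus_eq hT hsI, h.energy_rightLim hA htI,
      h.energy_leftLim hA hsI,
      ← intervalIntegral.integral_interval_sub_left (hint 0 t) (hint 0 s)]
    ring
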